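/- **Setting.** Let $d\ge 0$, $k\ge 1$, let $(\mathcal U,g)$ be a smooth $(d+k+1)$-dimensional manifold with a smooth Lorentzian metric of signature $(-,+,\dots,+)$, let $\Phi:\mathcal U\to\mathbb R$ be smooth with $d\Phi\ne0$ on $\mathcal M:=\Phi^{-1}(0)$, and equip the hypersurface $\mathcal M$ with a distance inducing its topology ("bounded" refers to this distance). Let $g^{\mathcal M}$ be the bilinear form induced on $\mathcal M$; assume that its kernel $\mathcal N\subset T\mathcal M$ (the null distribution) has constant rank $k$, and let $\mathcal S$ be a smooth distribution with $T\mathcal M=\mathcal N\oplus\mathcal S$; $\Pi_{\mathcal S}$ is the projection onto $\mathcal S$ along $\mathcal N$. Let $V$ be a $C^2$ vector field on $\mathcal M$, $V_{\mathcal S}=\Pi_{\mathcal S}V$. Let $\Psi:\mathcal M\to\mathbb R$ be a $C^2$ function with $d\Psi|_{\mathcal N}=0$ and $d\Psi(V_{\mathcal S})\le -c\,g^{\mathcal M}(V_{\mathcal S},V_{\mathcal S})$ on $\mathcal M$ for some constant $c>0$. **Theorem 3.** Suppose that 1. $V$ generates a continuous semiflow $\varphi_t$ ($t\ge0$) on $\mathcal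 M$ which is asymptotically compact (for every bounded sequence $X_j$ and every $t_j\to\infty$ the sequence $\varphi_{t_j}(X_j)$ has a convergent subsequence) and has a bounded absorbing set (a bounded set $B$ such that for every bounded $D$ one has $\varphi_t(D)\subset B$ for all large $t$); 2. $\mathcal N$ is involutive, its leaves are compact and embedded, and the foliation is simple: the leaf space $\mathcal M_{\rm red}$ is a smooth (Hausdorff, second countable) $d$-manifold for which the projection $\pi:\mathcal M\to\mathcal M_{\rm red}$ is a smooth surjective submersion with $\ker D\pi=\mathcal N$ whose fibres are the leaves; 3. $V$ is projectable: there is a vector field $V_*$ on $\mathcal M_{\rm red}$ with $D\pi_X(V(X))=V_*(\pi(X))$ for all $X\in\mathcal M$; 4. (transversal Morse condition) at every $X\in\mathcal M$ with $d\Psi(X)=0$ and $d\Psi(V)(X)=0$ the Hessian $D^2\Psi(X)|_{\mathcal S_X}$ is nondegenerate; 5. (uniform spectral gap) there is $\eta>0$ such that for every $X$ in the global attractor $\mathcal A$ of $\varphi$ (the compact set with $\varphi_t(\mathcal A)=\mathcal A$ for all $t\ge 0$ which attracts every bounded set), $\sigma(L_X^{\mathcal S})\cap\{z\in\mathbb C:\operatorname{Re}z\ge-\eta\}=\varnothing$,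 where $L^{\mathcal S}_X=\Pi_{\mathcal S_X}\circ DV(X)|_{\mathcal S_X}$ and $DV(X)$ is computed in some foliated chart around $X$, i.e. a smooth chart of $\mathcal M$ in which $\mathcal N$ is a constant distribution. (If $V_{\mathcal S}(X)=0$, then $L_X^{\mathcal S}$ does not depend on the foliated chart; otherwise it is enough that the condition holds in one foliated chart around $X$.) Then the global attractor $\mathcal A$ exists, there is a continuous semiflow $\psi_t$ on $\mathcal M_{\rm red}$ generated by $V_*$ with $\psi_t\circ\pi=\pi\circ\varphi_t$ (the reduced semiflow), and $\mathcal A_*:=\pi(\mathcal A)$ is compact, satisfies $\psi_t(\mathcal A_*)=\mathcal A_*$ for all $t\ge0$, and is locally finite-dimensional (each of its points has a neighbourhood in $\mathcal A_*$ of finite covering dimension). Moreover there are no neutral directions along $\mathcal A_*$: for every $Y\in\mathcal A_*$ the linearization $DV_*(Y)$, computed in any smooth chart around $Y$, satisfies $\sigma(DV_*(Y))\cap i\mathbb R=\varnothing$. -/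

import Mathlib

open Set Filter Topology Manifold Bornology
open scoped ContDiff NNReal TensorProduct

noncomputable section

namespace TransversalReduction

/-! ### Ambient Lorentzian geometry and the constraint hypersurface -/

/-- A smooth Lorentzian metric of signature `(-,+,…,+)` on an `(n+1)`-dimensional manifold. -/
structure LorentzianMetric (n : ℕ) (U : Type*) [TopologicalSpace U]
    [ChartedSpace (EuclideanSpace ℝ (Fin (n + 1))) U] [IsManifold (𝓡 (n + 1)) ∞ U] where
  /-- The bilinear form on each tangent space. -/
  val (x : U) : TangentSpace (𝓡 (n + 1)) x →L[ℝ] TangentSpace (𝓡 (n + 1)) x →L[ℝ] ℝ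
  symm (x : U) (v w : TangentSpace (𝓡 (n + 1)) x) : val x v w = val x w v
  signature (x : U) : ∃ b : Module.Basis (Fin (n + 1)) ℝ (TangentSpace (𝓡 (n + 1)) x),
    ∀ i j, val x (b i) (b j) = if i = j then (if i = 0 then -1 else 1) else 0
  contMDiff : ContMDiff (𝓡 (n + 1))
    ((𝓡 (n + 1)).prod 𝓘(ℝ, EuclideanSpace ℝ (Fin (n + 1)) →L[ℝ]
      EuclideanSpace ℝ (Fin (n + 1)) →L[ℝ] ℝ)) ∞
    (fun x ↦ Bundle.TotalSpace.mk' (EuclideanSpace ℝ (Fin (n + 1)) →L[ℝ]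
      EuclideanSpace ℝ (Fin (n + 1)) →L[ℝ] ℝ) x (val x))

/-- `ι : M → U` realizes the manifold `M` as the regular zero level set of the smooth function
`Φ` on `U`. This determines `M` as an embedded submanifold of `U`. -/
structure IsRegularZeroSet {m n : ℕ} {U M : Type*}
    [TopologicalSpace U] [ChartedSpace (EuclideanSpace ℝ (Fin n)) U]
    [TopologicalSpace M] [ChartedSpace (EuclideanSpace ℝ (Fin m)) M]
    (Φ : U → ℝ) (ι : M → U) : Prop where
  smooth : ContMDiff (𝓡 n) 𝓘(ℝ, ℝ) ∞ Φ
  regular : ∀ x, Φ x = 0 → mvfderiv (𝓡 n) Φ x ≠ 0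
  embedding : IsSmoothEmbedding (𝓡 m) (𝓡 n) ∞ ι
  range_eq : range ι = Φ ⁻¹' {0}

section Induced

variable {m n : ℕ} {U M : Type*}
  [TopologicalSpace U] [ChartedSpace (EuclideanSpace ℝ (Fin (n + 1))) U]
  [IsManifold (𝓡 (n + 1)) ∞ U]
  [TopologicalSpace M] [ChartedSpace (EuclideanSpace ℝ (Fin m)) M]

/-- The bilinear form induced on `M` by the ambient metric. -/
def inducedForm (g : LorentzianMetric n U) (ι : M → U) (x : M)
    (v w : TangentSpace (𝓡 m) x) : ℝ :=
  g.val (ι x) (mfderiv (𝓡 m) (𝓡 (n + 1)) ι x v) (mfderiv (𝓡 m) (𝓡 (n + 1)) ι x w)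

/-- The null distribution: the pointwise kernel of the induced bilinear form. -/
def nullDistribution (g : LorentzianMetric n U) (ι : M → U) (x : M) :
    Submodule ℝ (TangentSpace (𝓡 m) x) where
  carrier := {v | ∀ w, inducedForm g ι x v w = 0}
  add_mem' {a b} ha hb w := by
    have h1 := ha w
    have h2 := hb w
    simp only [inducedForm] at h1 h2 ⊢
    rw [map_add, map_add, add_apply, h1, h2, add_zero]
  zero_mem' w := by
    simp only [inducedForm]
    rw [map_zero, map_zero, zero_apply]
  smul_mem' c a ha w := by
    have h1 := ha w
    simp only [inducedForm] at h1 ⊢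
    rw [map_smul, map_smul, smul_apply, h1, smul_zero]

end Induced

/-! ### Distributions, leaves and the leaf space -/

section Distributions

variable {m : ℕ} {M : Type*} [TopologicalSpace M] [ChartedSpace (EuclideanSpace ℝ (Fin m)) M]

/-- A `C^r` vector field. -/
def IsVectorFieldOfClass (r : ℕ∞ω) [IsManifold (𝓡 m) 1 M]
    (W : ∀ x : M, TangentSpace (𝓡 m) x) : Prop :=
  ContMDiff (𝓡 m) (𝓡 m).tangent r (fun x ↦ (⟨x, W x⟩ : TangentBundle (𝓡 m) M))

/-- A smooth distribution of constant rank `r`: a smooth subbundle of the tangent bundle. -/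
def IsSmoothDistribution [IsManifold (𝓡 m) 1 M]
    (D : ∀ x : M, Submodule ℝ (TangentSpace (𝓡 m) x)) (r : ℕ) : Prop :=
  (∀ x, Module.finrank ℝ (D x) = r) ∧
    ∀ x, ∀ v ∈ D x, ∃ W : ∀ y : M, TangentSpace (𝓡 m) y,
      IsVectorFieldOfClass ∞ W ∧ (∀ y, W y ∈ D y) ∧ W x = v

/-- Involutivity: the bracket of two smooth sections is again a section. -/
def IsInvolutive [IsManifold (𝓡 m) 1 M]
    (D : ∀ x : M, Submodule ℝ (TangentSpace (𝓡 m) x)) : Prop :=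
  ∀ W Z : ∀ x : M, TangentSpace (𝓡 m) x,
    IsVectorFieldOfClass ∞ W → IsVectorFieldOfClass ∞ Z →
    (∀ x, W x ∈ D x) → (∀ x, Z x ∈ D x) →
    ∀ x, VectorField.mlieBracket (𝓡 m) W Z x ∈ D x

/-- `a` and `b` are joined by a `C¹` curve everywhere tangent to `D`. -/
def TangentlyJoined (D : ∀ x : M, Submodule ℝ (TangentSpace (𝓡 m) x)) (a b : M) : Prop :=
  ∃ γ : ℝ → M, ContMDiff 𝓘(ℝ, ℝ) (𝓡 m) 1 γ ∧
    (∀ t, mfderiv 𝓘(ℝ, ℝ) (𝓡 m) γ t (1 : ℝ) ∈ D (γ t)) ∧ γ 0 = a ∧ γ 1 = b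

/-- The leaf of `D` through `x`: the points that can be reached from `x` along finitely many
curves tangent to `D`. -/
def leaf (D : ∀ x : M, Submodule ℝ (TangentSpace (𝓡 m) x)) (x : M) : Set M :=
  {y | Relation.EqvGen (TangentlyJoined D) x y}

/-- The manifold `R` together with `π : M → R` is the leaf space of the (simple) foliation tangent
to `D`: `π` is a smooth surjective submersion, tangent to `D`, whose fibres are the leaves of `D`.
In particular, the leaves are closed embedded submanifolds. -/
structure IsLeafSpace {d : ℕ} {R : Type*} [TopologicalSpace R]
    [ChartedSpace (EuclideanSpace ℝ (Fin d)) R]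
    (D : ∀ x : M, Submodule ℝ (TangentSpace (𝓡 m) x)) (π : M → R) : Prop where
  submersion : IsSubmersion (𝓡 m) (𝓡 d) ∞ π
  surjective : Function.Surjective π
  ker_eq : ∀ x, ∀ v : TangentSpace (𝓡 m) x, mfderiv (𝓡 m) (𝓡 d) π x v = 0 ↔ v ∈ D x
  fiber_eq : ∀ x, π ⁻¹' {π x} = leaf D x

/-- A smooth chart of `M` that carries `D` to a constant distribution (a foliated chart). -/
def IsFoliatedChart (D : ∀ x : M, Submodule ℝ (TangentSpace (𝓡 m) x))
    (χ : OpenPartialHomeomorph M (EuclideanSpace ℝ (Fin m))) : Prop :=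
  χ ∈ IsManifold.maximalAtlas (𝓡 m) ∞ M ∧
    ∃ F : Submodule ℝ (EuclideanSpace ℝ (Fin m)), ∀ x ∈ χ.source,
      ∀ v : TangentSpace (𝓡 m) x, v ∈ D x ↔ mfderiv (𝓡 m) (𝓡 m) χ x v ∈ F

/-- Expression of the vector field `W` in the chart `χ`. -/
def inChart (χ : OpenPartialHomeomorph M (EuclideanSpace ℝ (Fin m)))
    (W : ∀ x : M, TangentSpace (𝓡 m) x) (e : EuclideanSpace ℝ (Fin m)) :
    EuclideanSpace ℝ (Fin m) :=
  mfderiv (𝓡 m) (𝓡 m) χ (χ.symm e) (W (χ.symm e))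

/-- The linearization `DW(x) : T_x M → T_x M` of the vector field `W` at `x`, computed in the
chart `χ`: the derivative of the chart expression of `W`, carried back to `T_x M`. -/
def linearization (χ : OpenPartialHomeomorph M (EuclideanSpace ℝ (Fin m)))
    (W : ∀ x : M, TangentSpace (𝓡 m) x) (x : M) :
    TangentSpace (𝓡 m) x →L[ℝ] TangentSpace (𝓡 m) x :=
  (mfderiv (𝓡 m) (𝓡 m) χ x).inverse ∘L
    (fderiv ℝ (inChart χ W) (χ x) : EuclideanSpace ℝ (Fin m) →L[ℝ] EuclideanSpace ℝ (Fin m)) ∘L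
    mfderiv (𝓡 m) (𝓡 m) χ x

/-- The transversal linearization `Π_S ∘ DW(x)|_S` at `x` (with `DW(x)` computed in `χ`), where
`Π_S` is the projection onto `S x` along `N x`. -/
def transversalLinearization {N S : ∀ x : M, Submodule ℝ (TangentSpace (𝓡 m) x)}
    (hSN : ∀ x, IsCompl (S x) (N x)) (χ : OpenPartialHomeomorph M (EuclideanSpace ℝ (Fin m)))
    (W : ∀ x : M, TangentSpace (𝓡 m) x) (x : M) : S x →ₗ[ℝ] S x :=
  (S x).projectionOnto (N x) (hSN x) ∘ₗ
    (linearization χ W x : TangentSpace (𝓡 m) x →ₗ[ℝ] TangentSpace (𝓡 m) x) ∘ₗ (S x).subtype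

/-- The second derivative of `Ψ` at `x` in the preferred chart at `x`; at a critical point of `Ψ`
this is the (chart-independent) Hessian. -/
def hessian (Ψ : M → ℝ) (x : M) (v w : TangentSpace (𝓡 m) x) : ℝ :=
  let χ := chartAt (EuclideanSpace ℝ (Fin m)) x
  fderiv ℝ (fderiv ℝ (Ψ ∘ χ.symm)) (χ x)
    (mfderiv (𝓡 m) (𝓡 m) χ x v) (mfderiv (𝓡 m) (𝓡 m) χ x w)

end Distributions

/-- The spectrum in `ℂ` of a real linear operator, i.e. the spectrum of its complexification. -/
def complexSpectrum {E : Type*} [AddCommGroup E] [Module ℝ E] (L : E →ₗ[ℝ] E) : Set ℂ :=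
  spectrum ℂ (L.baseChange ℂ : Module.End ℂ (ℂ ⊗[ℝ] E))

/-! ### Dissipation -/

section Dissipation

variable {m n : ℕ} {U M : Type*}
  [TopologicalSpace U] [ChartedSpace (EuclideanSpace ℝ (Fin (n + 1))) U]
  [IsManifold (𝓡 (n + 1)) ∞ U]
  [TopologicalSpace M] [ChartedSpace (EuclideanSpace ℝ (Fin m)) M]

/-- `Ψ` is compatible with the distribution `N`: its differential vanishes on `N`. -/
def IsCompatible (N : ∀ x : M, Submodule ℝ (TangentSpace (𝓡 m) x)) (Ψ : M → ℝ) : Prop :=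
  ∀ x, ∀ v ∈ N x, mvfderiv (𝓡 m) Ψ x v = 0

/-- The transversal dissipation estimate `dΨ(V_S) ≤ -c ‖V_S‖²` for some `c > 0`, where `V_S` is the
`S`-component of `V` and `‖·‖` is the norm given by the restriction of the induced form to `S`. -/
def TransversalDissipation (g : LorentzianMetric n U) (ι : M → U)
    {S : ∀ x : M, Submodule ℝ (TangentSpace (𝓡 m) x)}
    (hSN : ∀ x, IsCompl (S x) (nullDistribution g ι x))
    (V : ∀ x : M, TangentSpace (𝓡 m) x) (Ψ : M → ℝ) : Prop :=
  ∃ c : ℝ, 0 < c ∧ ∀ x,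
    mvfderiv (𝓡 m) Ψ x ((S x).projection (nullDistribution g ι x) (hSN x) (V x)) ≤
      -c * inducedForm g ι x ((S x).projection (nullDistribution g ι x) (hSN x) (V x))
        ((S x).projection (nullDistribution g ι x) (hSN x) (V x))

/-- The degeneracy set `{x | dΨ(V)(x) = 0}`. -/
def degeneracySet (V : ∀ x : M, TangentSpace (𝓡 m) x) (Ψ : M → ℝ) : Set M :=
  {x | mvfderiv (𝓡 m) Ψ x (V x) = 0}

/-- Transversal Morse-type nondegeneracy: at each critical point of `Ψ` in the degeneracy set, the
Hessian of `Ψ` restricted to `S` is nondegenerate. -/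
def TransversallyMorse (S : ∀ x : M, Submodule ℝ (TangentSpace (𝓡 m) x))
    (V : ∀ x : M, TangentSpace (𝓡 m) x) (Ψ : M → ℝ) : Prop :=
  ∀ x ∈ degeneracySet V Ψ, mvfderiv (𝓡 m) Ψ x = 0 →
    ∀ v ∈ S x, v ≠ 0 → ∃ w ∈ S x, hessian Ψ x v w ≠ 0

end Dissipation

/-! ### Semiflows and attractors -/

/-- The continuous semiflow `φ` is generated by the vector field `V`. -/
def IsSemiflowOf {m : ℕ} {M : Type*} [TopologicalSpace M]
    [ChartedSpace (EuclideanSpace ℝ (Fin m)) M]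
    (φ : Flow ℝ≥0 M) (V : ∀ x : M, TangentSpace (𝓡 m) x) : Prop :=
  ∀ x, IsMIntegralCurveOn (I := 𝓡 m) (fun t : ℝ ↦ φ t.toNNReal x) V (Ici 0)

section Semiflows

variable {M : Type*} [PseudoMetricSpace M]

/-- Asymptotic compactness: for bounded `x_k` and `t_k → ∞`, the sequence `φ (t_k) (x_k)` has a
convergent subsequence. -/
def AsymptoticallyCompact (φ : Flow ℝ≥0 M) : Prop :=
  ∀ x : ℕ → M, IsBounded (range x) → ∀ t : ℕ → ℝ≥0, Tendsto t atTop atTop →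
    ∃ a : M, ∃ s : ℕ → ℕ, StrictMono s ∧ Tendsto (fun k ↦ φ (t (s k)) (x (s k))) atTop (𝓝 a)

/-- Existence of a bounded set absorbing every bounded set. -/
def HasBoundedAbsorbingSet (φ : Flow ℝ≥0 M) : Prop :=
  ∃ B : Set M, IsBounded B ∧
    ∀ D : Set M, IsBounded D → ∃ T : ℝ≥0, ∀ t, T ≤ t → φ t '' D ⊆ B

/-- `A` is the global attractor of `φ`: compact, invariant, and attracting every bounded set. -/
structure IsGlobalAttractor (φ : Flow ℝ≥0 M) (A : Set M) : Prop where
  isCompact : IsCompact A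
  invariant : ∀ t, φ t '' A = A
  attracts : ∀ D : Set M, IsBounded D → ∀ ε : ℝ, 0 < ε →
    ∃ T : ℝ≥0, ∀ t, T ≤ t → φ t '' D ⊆ Metric.thickening ε A

end Semiflows

/-! ### Covering dimension -/

/-- The covering dimension of `X` is at most `n`: every finite open cover has an open refinement
such that each point lies in at most `n + 1` of its members. -/
def CoveringDimLE (X : Type*) [TopologicalSpace X] (n : ℕ) : Prop :=
  ∀ c : Set (Set X), c.Finite → (∀ u ∈ c, IsOpen u) → ⋃₀ c = univ →
    ∃ r : Set (Set X), (∀ u ∈ r, IsOpen u) ∧ ⋃₀ r = univ ∧ (∀ u ∈ r, ∃ v ∈ c, u ⊆ v) ∧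
      ∀ x, {u ∈ r | x ∈ u}.encard ≤ n + 1

/-- Each point of `s` has a neighbourhood in `s` of finite covering dimension. -/
def LocallyFiniteDimensional {X : Type*} [TopologicalSpace X] (s : Set X) : Prop :=
  ∀ y ∈ s, ∃ u ∈ 𝓝[s] y, u ⊆ s ∧ ∃ n : ℕ, CoveringDimLE u n

end TransversalReduction

end

open TransversalReduction

/-! The reduced attractor turns out to consist of linearly stable equilibria, so neutral directions
are impossible. The attractor `A` is the ω-limit set of the absorbing set, and the semiflow descends
to the leaf space because projections of integral curves solve the equation of `VR`, where solutions
are unique.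

Fix `x ∈ A`. Invariance gives orbit segments in `A` of arbitrary length ending at `x`. Since `Ψ` is
bounded on `A`, the mean value theorem finds on them points where `dΨ(V)` is arbitrarily small, and
these accumulate at some `p ∈ A` with `dΨ(V)(p) = 0` (`exists_zero_of_hasDerivAt_along_flow`). There
the dissipation estimate makes `V_S(p)` non-spacelike. It is also orthogonal to a nonzero null
vector, so Lorentzian signature puts it in the null distribution
(`TransversalDissipation.mem_nullDistribution`). Hence `V(p)` is tangent to its leaf and `π p` is an
equilibrium of `VR`.

At such a point `dπ` conjugates the transversal linearization to that of `VR`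
(`complexSpectrum_transversalLinearization`), so the spectral gap makes `π p` Lyapunov stable
(`IsSemiflowOf.stable_of_complexSpectrum`). But points arbitrarily close to `p` flow to `x`, and
stability then forces `π x = π p`. Thus every point of `π '' A` is an equilibrium with spectrum in
the open left half-plane. -/

/-! ### Existence of the global attractor -/

/-- The ω-limit set of `B`, described by sequences. -/
def seqOmegaLimit {M : Type*} [PseudoMetricSpace M] (φ : Flow ℝ≥0 M) (B : Set M) : Set M :=
  {a | ∃ x : ℕ → M, (∀ n, x n ∈ B) ∧ ∃ t : ℕ → ℝ≥0, Tendsto t atTop atTop ∧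
    Tendsto (fun n ↦ φ (t n) (x n)) atTop (𝓝 a)}

section Attractor

variable {M : Type*} [MetricSpace M] {φ : Flow ℝ≥0 M} {B : Set M}

/-- After an initial time `T` all the points lie in `B`. Asymptotic compactness applied to the
remaining times `t n - T` gives a limit that is an ω-limit point of `B` by definition. -/
theorem TransversalReduction.AsymptoticallyCompact.exists_subseq_mem_seqOmegaLimit (hφ : AsymptoticallyCompact φ)
    (hB : IsBounded B)
    (habs : ∀ D : Set M, IsBounded D → ∃ T : ℝ≥0, ∀ t, T ≤ t → φ t '' D ⊆ B)
    {D : Set M} (hD : IsBounded D) {x : ℕ → M} (hx : ∀ n, x n ∈ D) {t : ℕ → ℝ≥0}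
    (ht : Tendsto t atTop atTop) :
    ∃ a ∈ seqOmegaLimit φ B, ∃ s : ℕ → ℕ, StrictMono s ∧
      Tendsto (fun k ↦ φ (t (s k)) (x (s k))) atTop (𝓝 a) := by
  obtain ⟨T, hT⟩ := habs D hD
  have hsub : Tendsto (fun n ↦ t n - T) atTop atTop := by
    refine tendsto_atTop.2 fun b ↦ ?_
    filter_upwards [tendsto_atTop.1 ht (b + T)] with n hn
    exact le_tsub_of_add_le_right hn
  have hmem : ∀ n, φ T (x n) ∈ B := fun n ↦ hT T le_rfl ⟨x n, hx n, rfl⟩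
  obtain ⟨a, s, hs, ha⟩ := hφ (fun n ↦ φ T (x n))
    (hB.subset (range_subset_iff.2 hmem)) (fun n ↦ t n - T) hsub
  have heq : ∀ᶠ n in atTop, φ (t n - T) (φ T (x n)) = φ (t n) (x n) := by
    filter_upwards [tendsto_atTop.1 ht T] with n hn
    rw [← φ.map_add, tsub_add_cancel_of_le hn]
  refine ⟨a, ⟨fun n ↦ φ T (x (s n)), fun n ↦ hmem _, fun n ↦ t (s n) - T,
    hsub.comp hs.tendsto_atTop, ha⟩, s, hs, ?_⟩
  refine ha.congr' ?_
  filter_upwards [hs.tendsto_atTop.eventually heq] with n hn using hn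

/-- Compactness, negative invariance and attraction each come from extracting a limit with the
previous lemma: along a diagonal sequence, along times shifted back by `t`, and along a hypothetical
sequence that escapes the thickening. -/
theorem TransversalReduction.AsymptoticallyCompact.isGlobalAttractor_seqOmegaLimit (hφ : AsymptoticallyCompact φ)
    (hB : IsBounded B)
    (habs : ∀ D : Set M, IsBounded D → ∃ T : ℝ≥0, ∀ t, T ≤ t → φ t '' D ⊆ B) :
    IsGlobalAttractor φ (seqOmegaLimit φ B) := by
  refine ⟨?_, fun t ↦ Subset.antisymm ?_ ?_, ?_⟩
  · refine IsSeqCompact.isCompact fun a ha ↦ ?_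
    choose x hx t ht hlim using ha
    have h1 : ∀ n : ℕ, ∃ k, (n : ℝ≥0) ≤ t n k ∧ dist (φ (t n k) (x n k)) (a n) < 1 / ((n : ℝ) + 1) := by
      intro n
      have := (tendsto_atTop.1 (ht n) (n : ℝ≥0)).and
        ((Metric.tendsto_nhds.1 (hlim n)) (1 / ((n : ℝ) + 1)) (by positivity))
      exact this.exists
    choose k hk1 hk2 using h1
    obtain ⟨b, hb, s, hs, hlim'⟩ := hφ.exists_subseq_mem_seqOmegaLimit hB habs hB
      (x := fun n ↦ x n (k n)) (fun n ↦ hx _ _) (t := fun n ↦ t n (k n))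
      (tendsto_atTop_mono hk1 tendsto_natCast_atTop_atTop)
    refine ⟨b, hb, s, hs, ?_⟩
    refine tendsto_of_tendsto_of_dist hlim' ?_
    refine squeeze_zero (fun _ ↦ dist_nonneg) (fun n ↦ (hk2 (s n)).le) ?_
    exact tendsto_one_div_add_atTop_nhds_zero_nat.comp hs.tendsto_atTop
  · rintro _ ⟨a, ⟨x, hx, τ, hτ, ha⟩, rfl⟩
    refine ⟨x, hx, fun n ↦ t + τ n, tendsto_atTop_mono (fun n ↦ le_add_self) hτ, ?_⟩
    simp only [φ.map_add]
    exact ((φ.continuous_toFun t).tendsto a).comp ha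
  · rintro a ⟨x, hx, τ, hτ, ha⟩
    have hsub : Tendsto (fun n ↦ τ n - t) atTop atTop := by
      refine tendsto_atTop.2 fun b ↦ ?_
      filter_upwards [tendsto_atTop.1 hτ (b + t)] with n hn
      exact le_tsub_of_add_le_right hn
    obtain ⟨b, hb, s, hs, hlim⟩ := hφ.exists_subseq_mem_seqOmegaLimit hB habs hB hx hsub
    refine ⟨b, hb, ?_⟩
    refine tendsto_nhds_unique (((φ.continuous_toFun t).tendsto b).comp hlim) ?_
    refine (ha.comp hs.tendsto_atTop).congr' ?_
    filter_upwards [hs.tendsto_atTop.eventually (tendsto_atTop.1 hτ t)] with n hn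
    simp only [Function.comp_apply]
    rw [← φ.map_add, add_tsub_cancel_of_le hn]
  · intro D hD ε hε
    by_contra! hcon
    have h1 : ∀ n : ℕ, ∃ t : ℝ≥0, (n : ℝ≥0) ≤ t ∧ ∃ x ∈ D,
        φ t x ∉ Metric.thickening ε (seqOmegaLimit φ B) := by
      intro n
      obtain ⟨t, ht, hsub⟩ := hcon n
      obtain ⟨_, ⟨x, hx, rfl⟩, hn⟩ := not_subset.1 hsub
      exact ⟨t, ht, x, hx, hn⟩
    choose t ht x hx hn using h1
    obtain ⟨a, ha, s, hs, hlim⟩ := hφ.exists_subseq_mem_seqOmegaLimit hB habs hD hx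
      (tendsto_atTop_mono ht tendsto_natCast_atTop_atTop)
    obtain ⟨k, hk⟩ := ((Metric.tendsto_nhds.1 hlim) ε hε).exists
    exact hn _ (Metric.mem_thickening_iff.2 ⟨a, ha, hk⟩)

end Attractor

/-! ### Spectra and quadratic Lyapunov functions -/

section Spectral

/-- Gelfand's formula: the spectrum is compact, so the spectral radius is below some `r < 1`, and
eventually `‖a ^ n‖ ≤ r ^ n`. -/
theorem spectrum.tendsto_pow_atTop_nhds_zero {A : Type*} [NormedRing A] [NormedAlgebra ℂ A]
    [CompleteSpace A] {a : A} (ha : ∀ z ∈ spectrum ℂ a, ‖z‖ < 1) :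
    Tendsto (fun n : ℕ ↦ a ^ n) atTop (𝓝 0) := by
  rcases subsingleton_or_nontrivial A with h | h
  · simp only [Subsingleton.elim _ (0 : A)]
    exact tendsto_const_nhds
  have hr : spectralRadius ℂ a < (1 : ℝ≥0) :=
    spectrum.spectralRadius_lt_of_forall_lt a fun z hz ↦ by exact_mod_cast ha z hz
  obtain ⟨r, hr0, hr1⟩ := exists_between hr
  have hr1' : r < 1 := by simpa using hr1
  have h2 := (spectrum.pow_nnnorm_pow_one_div_tendsto_nhds_spectralRadius a).eventually_lt_const hr0
  rw [tendsto_zero_iff_norm_tendsto_zero]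
  lift r to ℝ≥0 using hr1'.ne_top
  have hr1'' : (r : ℝ) < 1 := by exact_mod_cast hr1'
  refine squeeze_zero' (Eventually.of_forall fun _ ↦ norm_nonneg _) ?_
    (tendsto_pow_atTop_nhds_zero_of_lt_one r.2 hr1'')
  filter_upwards [h2, eventually_gt_atTop 0] with n hn hn0
  have h3 : ((‖a ^ n‖₊ : ENNReal) ^ (1 / n : ℝ)) ^ (n : ℝ) ≤ (r : ENNReal) ^ (n : ℝ) :=
    ENNReal.rpow_le_rpow hn.le (by positivity)
  rw [← ENNReal.rpow_mul, one_div_mul_cancel (by positivity), ENNReal.rpow_one,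
    ENNReal.rpow_natCast] at h3
  exact_mod_cast h3

theorem Matrix.tendsto_pow_atTop_nhds_zero_of_spectrum {ι : Type*} [Fintype ι] [DecidableEq ι]
    {B : Matrix ι ι ℝ} (hB : ∀ z ∈ spectrum ℂ (B.map (algebraMap ℝ ℂ)), ‖z‖ < 1) :
    Tendsto (fun n : ℕ ↦ B ^ n) atTop (𝓝 0) := by
  let _ := Matrix.linftyOpNormedRing (n := ι) (α := ℂ)
  let _ := Matrix.linftyOpNormedAlgebra (n := ι) (R := ℂ) (α := ℂ)
  have h := spectrum.tendsto_pow_atTop_nhds_zero hB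
  refine tendsto_pi_nhds.2 fun i ↦ tendsto_pi_nhds.2 fun j ↦ ?_
  have hij := (Complex.continuous_re.tendsto _).comp (tendsto_pi_nhds.1 (tendsto_pi_nhds.1 h i) j)
  convert! hij using 2 with n
  simp only [Function.comp_apply]
  rw [← RingHom.mapMatrix_apply, ← map_pow]
  simp

theorem complexSpectrum_eq_spectrum_map_toMatrix {E ι : Type*} [AddCommGroup E] [Module ℝ E]
    [Fintype ι] [DecidableEq ι] (b : Module.Basis ι ℝ E) (L : E →ₗ[ℝ] E) :
    complexSpectrum L = spectrum ℂ ((LinearMap.toMatrix b b L).map (algebraMap ℝ ℂ)) := by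
  rw [← LinearMap.toMatrix_baseChange]
  exact (AlgEquiv.spectrum_eq (LinearMap.toMatrixAlgEquiv (Algebra.TensorProduct.basis ℂ b)) _).symm

/-- In a basis and its image under `T`, both operators have the same matrix. -/
theorem complexSpectrum_conj {E F : Type*} [AddCommGroup E] [Module ℝ E] [AddCommGroup F]
    [Module ℝ F] [FiniteDimensional ℝ E] (T : E ≃ₗ[ℝ] F) {L : E →ₗ[ℝ] E} {L' : F →ₗ[ℝ] F}
    (h : ∀ v, T (L v) = L' (T v)) : complexSpectrum L = complexSpectrum L' := by
  let b := Module.finBasis ℝ E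
  rw [complexSpectrum_eq_spectrum_map_toMatrix b, complexSpectrum_eq_spectrum_map_toMatrix (b.map T)]
  congr 2
  ext i j
  simp [LinearMap.toMatrix_apply, ← h]

/-- For a real matrix whose spectrum lies in the open left half-plane, `1 + h A` is a contraction
up to powers for small `h > 0`. -/
theorem Matrix.exists_spectrum_one_add_smul_lt {ι : Type*} [Fintype ι] [DecidableEq ι]
    {A : Matrix ι ι ℂ} (hA : ∀ z ∈ spectrum ℂ A, z.re < 0) :
    ∃ h : ℝ, 0 < h ∧ ∀ z ∈ spectrum ℂ (1 + (h : ℂ) • A), ‖z‖ < 1 := by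
  have hfin : (spectrum ℂ A).Finite := Matrix.finite_spectrum A
  have h1 : ∀ z ∈ spectrum ℂ A, ∀ᶠ h : ℝ in 𝓝[>] 0, ‖1 + (h : ℂ) * z‖ < 1 := by
    intro z hz
    have hz0 := hA z hz
    -- `|1 + hz|² = 1 + h (2 Re z + h |z|²)`, so any `h` below `-2 Re z / |z|²` works; the `+ 1`
    -- only keeps the denominator visibly positive.
    have hpos : 0 < -2 * z.re / (Complex.normSq z + 1) := by
      have := Complex.normSq_nonneg z
      apply div_pos <;> linarith
    filter_upwards [Ioo_mem_nhdsGT hpos] with h hh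
    have hn := Complex.normSq_nonneg z
    have h2 : h * (Complex.normSq z + 1) < -2 * z.re := (lt_div_iff₀ (by linarith)).1 hh.2
    have h3 : ‖1 + (h : ℂ) * z‖ ^ 2 < 1 := by
      rw [← Complex.normSq_eq_norm_sq]
      rw [Complex.normSq_apply] at h2 hn ⊢
      simp
      nlinarith [hh.1, mul_lt_mul_of_pos_left h2 hh.1, mul_pos hh.1 hh.1]
    exact (sq_lt_one_iff₀ (norm_nonneg _)).1 h3
  have h2 := (hfin.eventually_all (l := 𝓝[>] (0 : ℝ))).2 h1
  obtain ⟨h, hh, hpos⟩ := (h2.and self_mem_nhdsWithin).exists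
  refine ⟨h, hpos, fun z hz ↦ ?_⟩
  -- Affine spectral mapping: shifting by `1` and rescaling by the unit `h` brings `z` back to the
  -- spectrum of `A`.
  let u : ℂˣ := Units.mk0 (h : ℂ) (by exact_mod_cast hpos.ne')
  have h3 : z - 1 ∈ spectrum ℂ (u • A) := by
    rw [← spectrum.add_mem_add_iff (s := 1)]
    simpa [u, Units.smul_def] using hz
  have h4 : u⁻¹ • (z - 1) ∈ spectrum ℂ A := by
    rw [← spectrum.smul_mem_smul_iff (r := u)]
    simpa using h3
  have h5 := hh _ h4
  have h6 : 1 + (h : ℂ) * (u⁻¹ • (z - 1)) = z := by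
    have : (h : ℂ) ≠ 0 := by exact_mod_cast hpos.ne'
    simp only [u, Units.smul_def, Units.val_inv_eq_inv_val, Units.val_mk0, smul_eq_mul]
    field_simp
    ring
  rwa [h6] at h5

open scoped InnerProductSpace in
/-- **Lyapunov's theorem**: an operator whose spectrum lies in the open left half-plane admits a
quadratic Lyapunov function. -/
theorem exists_quadratic_lyapunov {E : Type*} [NormedAddCommGroup E] [InnerProductSpace ℝ E]
    [FiniteDimensional ℝ E] (A : E →L[ℝ] E)
    (hA : ∀ z ∈ complexSpectrum (A : E →ₗ[ℝ] E), z.re < 0) :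
    ∃ Q : E →L[ℝ] E →L[ℝ] ℝ, (∀ x y, Q x y = Q y x) ∧ (∀ x, ‖x‖ ^ 2 ≤ Q x x) ∧
      ∃ a : ℝ, 0 < a ∧ ∀ x, Q x (A x) ≤ -a * ‖x‖ ^ 2 := by
  let b := Module.finBasis ℝ E
  rw [complexSpectrum_eq_spectrum_map_toMatrix b] at hA
  obtain ⟨h, hpos, hh⟩ := Matrix.exists_spectrum_one_add_smul_lt hA
  -- One explicit Euler step. Its powers tend to zero, so a finite sum replaces the usual integral
  -- of the exponential.
  let B : E →L[ℝ] E := 1 + h • A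
  have hBmat : (1 : Matrix _ _ ℂ) + (h : ℂ) • (LinearMap.toMatrix b b (A : E →ₗ[ℝ] E)).map
      (algebraMap ℝ ℂ) = (LinearMap.toMatrixAlgEquiv b (B : E →ₗ[ℝ] E)).map (algebraMap ℝ ℂ) := by
    have hB : (B : E →ₗ[ℝ] E) = 1 + h • (A : E →ₗ[ℝ] E) := rfl
    have hA' : LinearMap.toMatrix b b (A : E →ₗ[ℝ] E) =
      LinearMap.toMatrixAlgEquiv b (A : E →ₗ[ℝ] E) := rfl
    rw [hB, hA', map_add, map_smul, map_one]
    ext i j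
    simp [Matrix.one_apply, apply_ite]
  rw [hBmat] at hh
  have h1 := Matrix.tendsto_pow_atTop_nhds_zero_of_spectrum hh
  let Λ : Matrix _ _ ℝ →ₗ[ℝ] (E →L[ℝ] E) :=
    LinearMap.toContinuousLinearMap.toLinearMap ∘ₗ (LinearMap.toMatrixAlgEquiv b).symm.toLinearMap
  have hΛ : Continuous Λ := Λ.continuous_of_finiteDimensional
  have h2 : Tendsto (fun n : ℕ ↦ B ^ n) atTop (𝓝 0) := by
    have := (hΛ.tendsto 0).comp h1
    rw [map_zero] at this
    convert! this using 2 with n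
    have hpow : (LinearMap.toMatrixAlgEquiv b).symm
        ((LinearMap.toMatrixAlgEquiv b (B : E →ₗ[ℝ] E)) ^ n) = (B : E →ₗ[ℝ] E) ^ n := by
      rw [← map_pow, AlgEquiv.symm_apply_apply]
    ext x
    simp only [Function.comp_apply, Λ, LinearMap.comp_apply, AlgEquiv.toLinearMap_apply,
      LinearEquiv.coe_coe, LinearMap.coe_toContinuousLinearMap', hpow]
    rw [← ContinuousLinearMap.toLinearMap_pow]
    rfl
  have h3 : ∀ᶠ n : ℕ in atTop, ‖B ^ n‖ < 1 / 2 := by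
    have := (continuous_norm.tendsto _).comp h2
    rw [norm_zero] at this
    exact this.eventually_lt_const (by norm_num)
  obtain ⟨N, hN, hN0⟩ := (h3.and (eventually_gt_atTop 0)).exists
  -- The sum telescopes: `Q(Bx, Bx) - Q(x, x) = ‖B ^ N x‖² - ‖x‖² ≤ -(3/4) ‖x‖²`. Expanding `B = 1 +
  -- hA` and dropping `h² Q(Ax, Ax) ≥ 0` leaves `2h Q(x, Ax) ≤ -(3/4) ‖x‖²`, whence the rate `3 /
  -- (8h)`.
  let Q : E →L[ℝ] E →L[ℝ] ℝ :=
    ∑ n ∈ Finset.range N, (innerSL ℝ).bilinearComp (B ^ n) (B ^ n)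
  have hQ : ∀ x y, Q x y = ∑ n ∈ Finset.range N, ⟪(B ^ n) x, (B ^ n) y⟫_ℝ := by
    intro x y
    simp [Q]
  have hself : ∀ x, Q x x = ∑ n ∈ Finset.range N, ‖(B ^ n) x‖ ^ 2 := by
    intro x
    simp [hQ]
  have hsymm : ∀ x y, Q x y = Q y x := fun x y ↦ by
    simp only [hQ]
    exact Finset.sum_congr rfl fun n _ ↦ real_inner_comm _ _
  have hnn : ∀ x, 0 ≤ Q x x := fun x ↦ by
    rw [hself]; positivity
  refine ⟨Q, hsymm, fun x ↦ ?_, 3 / (8 * h), by positivity, fun x ↦ ?_⟩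
  · rw [hself]
    have := Finset.single_le_sum (f := fun n ↦ ‖(B ^ n) x‖ ^ 2) (fun n _ ↦ by positivity)
      (Finset.mem_range.2 hN0)
    simpa using this
  · have hBx : B x = x + h • A x := rfl
    have e1 : Q (B x) (B x) = Q x x - ‖x‖ ^ 2 + ‖(B ^ N) x‖ ^ 2 := by
      rw [hself, hself]
      have h4 : ∀ n, (B ^ n) (B x) = (B ^ (n + 1)) x := fun n ↦ by
        rw [pow_succ]; rfl
      simp only [h4]
      have := Finset.sum_range_succ' (fun n ↦ ‖(B ^ n) x‖ ^ 2) N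
      rw [Finset.sum_range_succ] at this
      simp only [pow_zero, one_apply_eq_self] at this
      linarith
    have e2 : Q (B x) (B x) = Q x x + 2 * h * Q x (A x) + h ^ 2 * Q (A x) (A x) := by
      rw [hBx]
      simp only [map_add, map_smul, add_apply, smul_apply, smul_eq_mul]
      rw [hsymm (A x) x]
      ring
    have e3 : ‖(B ^ N) x‖ ^ 2 ≤ 1 / 4 * ‖x‖ ^ 2 := by
      have := (B ^ N).le_of_opNorm_le hN.le x
      calc ‖(B ^ N) x‖ ^ 2 ≤ (1 / 2 * ‖x‖) ^ 2 := by gcongr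
        _ = _ := by ring
    have e4 : 2 * h * Q x (A x) ≤ -(3 / 4) * ‖x‖ ^ 2 := by
      nlinarith [mul_nonneg (sq_nonneg h) (hnn (A x))]
    rw [neg_mul, div_mul_eq_mul_div, le_neg, div_le_iff₀ (by positivity)]
    nlinarith

end Spectral

/-! ### Lyapunov stability of equilibria on a manifold -/

section Stability

variable {d : ℕ} {R : Type*} [TopologicalSpace R] [ChartedSpace (EuclideanSpace ℝ (Fin d)) R]

theorem inChart_apply {χ : OpenPartialHomeomorph R (EuclideanSpace ℝ (Fin d))}
    (V : ∀ x : R, TangentSpace (𝓡 d) x) {y : R} (hy : y ∈ χ.source) :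
    inChart χ V (χ y) = mfderiv (𝓡 d) (𝓡 d) χ y (V y) := by
  unfold inChart
  rw [χ.left_inv hy]

theorem HasMFDerivAt.hasDerivAt_chart_comp [IsManifold (𝓡 d) 1 R]
    {χ : OpenPartialHomeomorph R (EuclideanSpace ℝ (Fin d))}
    (hχ : χ ∈ IsManifold.maximalAtlas (𝓡 d) 1 R) {V : ∀ x : R, TangentSpace (𝓡 d) x} {γ : ℝ → R}
    {t : ℝ} (hγ : HasMFDerivAt 𝓘(ℝ, ℝ) (𝓡 d) γ t ((1 : ℝ →L[ℝ] ℝ).smulRight (V (γ t))))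
    (ht : γ t ∈ χ.source) : HasDerivAt (χ ∘ γ) (inChart χ V (χ (γ t))) t := by
  have h1 := ((mdifferentiableAt_of_mem_maximalAtlas hχ ht).hasMFDerivAt).comp t hγ
  let L : ℝ →L[ℝ] EuclideanSpace ℝ (Fin d) :=
    (mfderiv (𝓡 d) (𝓡 d) χ (γ t)).comp ((1 : ℝ →L[ℝ] ℝ).smulRight (V (γ t)))
  have h2 : HasFDerivAt (χ ∘ γ) L t := hasMFDerivAt_iff_hasFDerivAt.1 h1
  have h3 : inChart χ V (χ (γ t)) = mfderiv (𝓡 d) (𝓡 d) χ (γ t) ((1 : ℝ) • V (γ t)) := by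
    rw [inChart_apply V ht, one_smul]
  rw [h3]
  exact h2.hasDerivAt

theorem TransversalReduction.IsSemiflowOf.hasMFDerivAt {ψ : Flow ℝ≥0 R}
    {V : ∀ x : R, TangentSpace (𝓡 d) x} (hψ : IsSemiflowOf ψ V) (y : R) {t : ℝ} (ht : 0 < t) :
    HasMFDerivAt 𝓘(ℝ, ℝ) (𝓡 d) (fun s : ℝ ↦ ψ s.toNNReal y) t
      ((1 : ℝ →L[ℝ] ℝ).smulRight (V (ψ t.toNNReal y))) :=
  (hψ y t ht.le).hasMFDerivAt (Ici_mem_nhds ht)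

/-- **Lyapunov's indirect method** for semiflows on a manifold: an equilibrium whose linearization
has its spectrum in the open left half-plane is stable. -/
theorem TransversalReduction.IsSemiflowOf.stable_of_complexSpectrum [T2Space R]
    [IsManifold (𝓡 d) 1 R] {ψ : Flow ℝ≥0 R} {V : ∀ x : R, TangentSpace (𝓡 d) x}
    (hψ : IsSemiflowOf ψ V) {p : R} (hp : V p = 0)
    {χ : OpenPartialHomeomorph R (EuclideanSpace ℝ (Fin d))}
    (hχ : χ ∈ IsManifold.maximalAtlas (𝓡 d) 1 R) (hpχ : p ∈ χ.source)
    (hdiff : DifferentiableAt ℝ (inChart χ V) (χ p))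
    (hspec : ∀ z ∈ complexSpectrum (fderiv ℝ (inChart χ V) (χ p) :
      EuclideanSpace ℝ (Fin d) →ₗ[ℝ] EuclideanSpace ℝ (Fin d)), z.re < 0)
    {U : Set R} (hU : U ∈ 𝓝 p) : ∃ W ∈ 𝓝 p, ∀ y ∈ W, ∀ t, ψ t y ∈ U := by
  set f := inChart χ V with hf
  set e₀ := χ p with he₀
  obtain ⟨Q, hsymm, hQ, a, ha, hQA⟩ := exists_quadratic_lyapunov (fderiv ℝ f e₀) hspec
  have hf0 : f e₀ = 0 := by
    rw [hf, he₀, inChart_apply V hpχ, hp, map_zero]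
    rfl
  -- With this bound on the first-order remainder, its contribution to `Q(e - e₀, f e)` is at most
  -- `a ‖e - e₀‖²`, exactly what the linear part gains.
  have hc : 0 < a / (‖Q‖ + 1) := by positivity
  have hev1 : ∀ᶠ e in 𝓝 e₀, Q (e - e₀) (f e) ≤ 0 := by
    filter_upwards [hdiff.hasFDerivAt.isLittleO.def hc] with e he
    rw [hf0, sub_zero] at he
    have h1 : Q (e - e₀) (f e) = Q (e - e₀) (fderiv ℝ f e₀ (e - e₀)) +
        Q (e - e₀) (f e - fderiv ℝ f e₀ (e - e₀)) := by
      rw [← map_add]; congr 1; abel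
    have h2 : Q (e - e₀) (f e - fderiv ℝ f e₀ (e - e₀)) ≤ a * ‖e - e₀‖ ^ 2 := by
      calc _ ≤ ‖Q (e - e₀) (f e - fderiv ℝ f e₀ (e - e₀))‖ := Real.le_norm_self _
        _ ≤ ‖Q‖ * ‖e - e₀‖ * ‖f e - fderiv ℝ f e₀ (e - e₀)‖ := Q.le_opNorm₂ _ _
        _ ≤ (‖Q‖ + 1) * ‖e - e₀‖ * (a / (‖Q‖ + 1) * ‖e - e₀‖) := by gcongr; linarith
        _ = a * ‖e - e₀‖ ^ 2 := by field_simp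
    have := hQA (e - e₀)
    linarith
  have hev2 : ∀ᶠ e in 𝓝 e₀, e ∈ χ.target ∧ χ.symm e ∈ U := by
    refine (χ.open_target.eventually_mem (χ.map_source hpχ)).and ?_
    refine (χ.continuousAt_symm (χ.map_source hpχ)).eventually ?_
    rwa [χ.left_inv hpχ]
  obtain ⟨r, hr, hball⟩ := Metric.eventually_nhds_iff_ball.1 (hev1.and hev2)
  have hlt : ∀ x, Q x x < r ^ 2 → ‖x‖ < r := fun x hx ↦
    lt_of_pow_lt_pow_left₀ 2 hr.le ((hQ x).trans_lt hx)
  let g : EuclideanSpace ℝ (Fin d) → ℝ := fun e ↦ Q (e - e₀) (e - e₀)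
  have hgc : Continuous g := by fun_prop
  have hgball : ∀ e, g e < r ^ 2 → e ∈ Metric.ball e₀ r := fun e he ↦ by
    rw [mem_ball_iff_norm]; exact hlt _ he
  -- Two nested sublevels: `{g ≤ q}` gives the compact trapping set `K`, and the open set `{g < r²}`
  -- leaves room to follow the orbit briefly beyond `K` with `g` still nonincreasing.
  let q := r ^ 2 / 2
  have hq : q < r ^ 2 := by simp only [q]; nlinarith [sq_pos_of_pos hr]
  have hq0 : 0 < q := by positivity
  let K := χ.symm '' {e | g e ≤ q}
  have hKc : IsCompact K := by
    refine IsCompact.image_of_continuousOn ?_ (χ.continuousOn_symm.mono ?_)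
    · refine Metric.isCompact_of_isClosed_isBounded (isClosed_le hgc continuous_const) ?_
      exact Metric.isBounded_ball.subset fun e he ↦ hgball e (lt_of_le_of_lt he hq)
    · exact fun e he ↦ (hball e (hgball e (lt_of_le_of_lt he hq))).2.1
  have hKmem : ∀ y, y ∈ K ↔ y ∈ χ.source ∧ g (χ y) ≤ q := by
    intro y
    constructor
    · rintro ⟨e, he, rfl⟩
      have het := (hball e (hgball e (lt_of_le_of_lt he hq))).2.1
      exact ⟨χ.map_target het, by rwa [χ.right_inv het]⟩
    · rintro ⟨hy, hy'⟩
      exact ⟨χ y, hy', χ.left_inv hy⟩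
  have hKU : K ⊆ U := by
    rintro _ ⟨e, he, rfl⟩
    exact (hball e (hgball e (lt_of_le_of_lt he hq))).2.2
  have hKnhds : K ∈ 𝓝 p := by
    have h1 : ∀ᶠ y in 𝓝 p, g (χ y) < q := by
      refine ((hgc.continuousAt).comp (χ.continuousAt hpχ)).eventually_lt_const ?_
      simpa [g, he₀] using hq0
    filter_upwards [h1, χ.open_source.mem_nhds hpχ] with y hy hy'
    exact (hKmem y).2 ⟨hy', hy.le⟩
  have hG : IsOpen (χ.source ∩ χ ⁻¹' {e | g e < r ^ 2}) :=
    χ.isOpen_inter_preimage (isOpen_lt hgc continuous_const)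
  refine ⟨K, hKnhds, fun y hy t ↦ hKU ?_⟩
  let γ : ℝ → R := fun s ↦ ψ s.toNNReal y
  have hγc : Continuous γ := by fun_prop
  suffices h : Icc (0 : ℝ) t ⊆ γ ⁻¹' K by
    have := h (right_mem_Icc.2 t.2)
    simpa [γ] using this
  -- Continuous induction on `[0, t]`: the times spent in `K` form a closed set, and from each of
  -- them the orbit stays in `K` a little longer.
  refine IsClosed.Icc_subset_of_forall_exists_gt
    ((hKc.isClosed.preimage hγc).inter isClosed_Icc) (by simpa [γ] using hy) ?_
  rintro s ⟨hsK, hs⟩ u hu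
  have hsG : γ s ∈ χ.source ∩ χ ⁻¹' {e | g e < r ^ 2} :=
    ⟨((hKmem _).1 hsK).1, ((hKmem _).1 hsK).2.trans_lt hq⟩
  obtain ⟨δ, hδ, hδG⟩ := Metric.isOpen_iff.1 (hG.preimage hγc) s hsG
  let s' := min u (s + δ / 2)
  have hss' : s < s' := lt_min hu (by linarith)
  have hIcc : ∀ τ ∈ Icc s s', γ τ ∈ χ.source ∩ χ ⁻¹' {e | g e < r ^ 2} := by
    intro τ hτ
    refine hδG ?_
    rw [Metric.mem_ball, Real.dist_eq, abs_of_nonneg (by linarith [hτ.1])]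
    have : τ ≤ s + δ / 2 := hτ.2.trans (min_le_right _ _)
    linarith
  have hderiv : ∀ τ ∈ Ioo s s', HasDerivAt (fun τ ↦ g (χ (γ τ)))
      (2 * Q (χ (γ τ) - e₀) (f (χ (γ τ)))) τ := by
    intro τ hτ
    have h1 := HasMFDerivAt.hasDerivAt_chart_comp hχ
      (hψ.hasMFDerivAt y (hs.1.trans_lt hτ.1)) (hIcc τ ⟨hτ.1.le, hτ.2.le⟩).1
    have h2 := h1.sub_const e₀
    have h3 := (Q.hasFDerivAt.comp_hasDerivAt τ h2).clm_apply h2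
    convert! h3 using 1
    simp only [Function.comp_apply]
    rw [two_mul, hsymm (inChart χ V _)]
  -- Only interior times need a derivative, so the merely one-sided derivative at time `0` is
  -- harmless.
  have hanti : AntitoneOn (fun τ ↦ g (χ (γ τ))) (Icc s s') := by
    refine antitoneOn_of_deriv_nonpos (convex_Icc _ _) ?_ ?_ ?_
    · refine hgc.comp_continuousOn (χ.continuousOn.comp hγc.continuousOn fun τ hτ ↦ (hIcc τ hτ).1)
    · rw [interior_Icc]
      exact fun τ hτ ↦ (hderiv τ hτ).differentiableAt.differentiableWithinAt
    · rw [interior_Icc]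
      intro τ hτ
      rw [(hderiv τ hτ).deriv]
      have := (hball _ (hgball _ (hIcc τ ⟨hτ.1.le, hτ.2.le⟩).2)).1
      linarith
  refine ⟨s', (hKmem _).2 ⟨(hIcc s' (right_mem_Icc.2 hss'.le)).1, ?_⟩, hss', min_le_left _ _⟩
  exact (hanti (left_mem_Icc.2 hss'.le) (right_mem_Icc.2 hss'.le) hss'.le).trans ((hKmem _).1 hsK).2

end Stability

/-! ### Submersions, projected vector fields and the reduced semiflow -/

section Submersion

variable {m d : ℕ} {M : Type*} [TopologicalSpace M] [ChartedSpace (EuclideanSpace ℝ (Fin m)) M]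
  {R : Type*} [TopologicalSpace R] [ChartedSpace (EuclideanSpace ℝ (Fin d)) R]

/-- In adapted charts `f` is a linear projection; freezing the complementary coordinate at its value
`c` at `x` gives the section. -/
theorem Manifold.IsSubmersionAt.exists_local_section {f : M → R} {x : M} {r : ℕ∞ω}
    (hf : IsSubmersionAt (𝓡 m) (𝓡 d) r f x) :
    ∃ σ : R → M, ContMDiffAt (𝓡 d) (𝓡 m) r σ (f x) ∧ σ (f x) = x ∧
      ∀ᶠ y in 𝓝 (f x), f (σ y) = y := by
  obtain ⟨F, _, _, h⟩ := hf
  have hdom : ∀ e ∈ h.domChart.target, h.codChart (f (h.domChart.symm e)) = (h.equiv e).1 := by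
    intro e he
    have h0 := h.writtenInCharts (show e ∈ (h.domChart.extend (𝓡 m)).target by simpa using he)
    simpa using h0
  let c := (h.equiv (h.domChart x)).2
  let A : EuclideanSpace ℝ (Fin d) → EuclideanSpace ℝ (Fin m) := fun u ↦ h.equiv.symm (u, c)
  have hA : ContDiff ℝ r A := by fun_prop
  have h0 : A (h.codChart (f x)) = h.domChart x := by
    have := hdom _ (h.domChart.map_source h.mem_domChart_source)
    rw [h.domChart.left_inv h.mem_domChart_source] at this
    simp only [A, c, this, Prod.mk.eta, ContinuousLinearEquiv.symm_apply_apply]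
  have hcod := contMDiffAt_of_mem_maximalAtlas h.codChart_mem_maximalAtlas h.mem_codChart_source
  have hAc : ContMDiffAt (𝓡 d) (𝓡 m) r (fun y ↦ A (h.codChart y)) (f x) :=
    (hA.contMDiff.contMDiffAt).comp (f x) hcod
  have hmem : h.domChart x ∈ h.domChart.target := h.domChart.map_source h.mem_domChart_source
  refine ⟨fun y ↦ h.domChart.symm (A (h.codChart y)), ?_, ?_, ?_⟩
  · have h1 := contMDiffAt_symm_of_mem_maximalAtlas h.domChart_mem_maximalAtlas
      (x := A (h.codChart (f x))) (by rwa [h0])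
    exact h1.comp (f x) hAc
  · simp only [h0, h.domChart.left_inv h.mem_domChart_source]
  · have h1 : ∀ᶠ y in 𝓝 (f x), A (h.codChart y) ∈ h.domChart.target :=
      hAc.continuousAt.eventually_mem (by rw [h0]; exact h.domChart.open_target.mem_nhds hmem)
    filter_upwards [h1, h.codChart.open_source.mem_nhds h.mem_codChart_source] with y hy hy'
    refine h.codChart.injOn (h.source_subset_preimage_source (h.domChart.map_target hy)) hy' ?_
    rw [hdom _ hy]
    simp [A]

theorem Manifold.IsSubmersionAt.mfderiv_surjective {f : M → R} {x : M}
    (hf : IsSubmersionAt (𝓡 m) (𝓡 d) ∞ f x) :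
    Function.Surjective (mfderiv (𝓡 m) (𝓡 d) f x) := by
  obtain ⟨σ, hσ, hσx, hfσ⟩ := hf.exists_local_section
  obtain ⟨F, _, _, h⟩ := hf
  have hfd : MDifferentiableAt (𝓡 m) (𝓡 d) f (σ (f x)) := by
    rw [hσx]; exact h.contMDiffAt.mdifferentiableAt (by simp)
  have h1 := hfd.hasMFDerivAt.comp (f x) (hσ.mdifferentiableAt (by simp)).hasMFDerivAt
  have h2 : HasMFDerivAt (𝓡 d) (𝓡 d) (f ∘ σ) (f x) (ContinuousLinearMap.id ℝ _) :=
    (hasMFDerivAt_id (f x)).congr_of_eventuallyEq hfσ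
  have h3 := hasMFDerivAt_unique h1 h2
  intro w
  have h4 := DFunLike.congr_fun h3 w
  rw [hσx] at h4
  exact ⟨_, h4⟩

theorem Manifold.IsSubmersion.isOpenMap {f : M → R} (hf : IsSubmersion (𝓡 m) (𝓡 d) ∞ f) :
    IsOpenMap f := by
  refine isOpenMap_iff_nhds_le.2 fun x ↦ ?_
  obtain ⟨σ, hσ, hσx, hfσ⟩ := (hf.isSubmersionAt x).exists_local_section
  have h1 : Tendsto σ (𝓝 (f x)) (𝓝 x) := by
    simpa [ContinuousAt, hσx] using hσ.continuousAt
  calc 𝓝 (f x) = map (f ∘ σ) (𝓝 (f x)) := by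
        conv_lhs => rw [← map_id (f := 𝓝 (f x))]
        exact (map_congr hfσ).symm
    _ ≤ map f (𝓝 x) := by rw [← map_map]; exact map_mono h1

/-- In adapted charts `f` is `e ↦ (e, 0)`, so the first coordinate supplies a smooth local left
inverse `τ`; differentiate `τ ∘ f = id`. -/
theorem Manifold.IsImmersionAt.mfderiv_injective {f : M → R} {x : M}
    (hf : IsImmersionAt (𝓡 m) (𝓡 d) ∞ f x) :
    Function.Injective (mfderiv (𝓡 m) (𝓡 d) f x) := by
  obtain ⟨F, _, _, h⟩ := hf
  have hdom : ∀ e ∈ h.domChart.target, h.codChart (f (h.domChart.symm e)) = h.equiv (e, 0) := by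
    intro e he
    have h0 := h.writtenInCharts (show e ∈ (h.domChart.extend (𝓡 m)).target by simpa using he)
    simpa using h0
  let A : EuclideanSpace ℝ (Fin d) → EuclideanSpace ℝ (Fin m) := fun u ↦ (h.equiv.symm u).1
  have hA : ContDiff ℝ ∞ A := by fun_prop
  have hAf : ∀ z ∈ h.domChart.source, A (h.codChart (f z)) = h.domChart z := by
    intro z hz
    have := hdom _ (h.domChart.map_source hz)
    rw [h.domChart.left_inv hz] at this
    simp [A, this]
  let τ : R → M := fun y ↦ h.domChart.symm (A (h.codChart y))
  have hτ : ContMDiffAt (𝓡 d) (𝓡 m) ∞ τ (f x) := by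
    have hcod := contMDiffAt_of_mem_maximalAtlas h.codChart_mem_maximalAtlas h.mem_codChart_source
    have h1 := contMDiffAt_symm_of_mem_maximalAtlas h.domChart_mem_maximalAtlas
      (x := A (h.codChart (f x)))
      (by rw [hAf x h.mem_domChart_source]; exact h.domChart.map_source h.mem_domChart_source)
    exact h1.comp (f x) ((hA.contMDiff.contMDiffAt).comp (f x) hcod)
  have h1 := (hτ.mdifferentiableAt (by simp)).hasMFDerivAt.comp x
    (h.contMDiffAt.mdifferentiableAt (by simp)).hasMFDerivAt
  have h2 : HasMFDerivAt (𝓡 m) (𝓡 m) (τ ∘ f) x (ContinuousLinearMap.id ℝ _) := by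
    refine (hasMFDerivAt_id x).congr_of_eventuallyEq ?_
    filter_upwards [h.domChart.open_source.mem_nhds h.mem_domChart_source] with z hz
    simp [τ, hAf z hz, h.domChart.left_inv hz]
  have h3 := hasMFDerivAt_unique h1 h2
  intro v w hvw
  have h4 := DFunLike.congr_fun h3 v
  have h5 := DFunLike.congr_fun h3 w
  simp only [ContinuousLinearMap.comp_apply, hvw] at h4 h5
  exact h4.symm.trans h5

/-- A vector field to which a vector field of class `C^2` projects along a submersion is `C^2`. -/
theorem Manifold.IsSubmersion.isVectorFieldOfClass_of_projectable [IsManifold (𝓡 m) ∞ M]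
    [IsManifold (𝓡 d) ∞ R] {π : M → R} (hπ : IsSubmersion (𝓡 m) (𝓡 d) ∞ π)
    (hsurj : Function.Surjective π) {V : ∀ x : M, TangentSpace (𝓡 m) x}
    (hV : IsVectorFieldOfClass 2 V) {VR : ∀ y : R, TangentSpace (𝓡 d) y}
    (hproj : ∀ x, mfderiv (𝓡 m) (𝓡 d) π x (V x) = VR (π x)) : IsVectorFieldOfClass 2 VR := by
  intro y
  obtain ⟨x, rfl⟩ := hsurj y
  obtain ⟨σ, hσ, hσx, hfσ⟩ := (hπ.isSubmersionAt x).exists_local_section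
  have h1 : ContMDiff (𝓡 m).tangent (𝓡 d).tangent 2 (tangentMap (𝓡 m) (𝓡 d) π) :=
    hπ.contMDiff.contMDiff_tangentMap (by norm_cast)
  -- Near `π x` the projected field is `Tπ ∘ V ∘ σ`, with `Tπ` and the local section `σ` smooth.
  have h2 := (h1.comp hV).contMDiffAt.comp (π x) (hσ.of_le (by norm_cast))
  refine h2.congr_of_eventuallyEq ?_
  filter_upwards [hfσ] with z hz
  have := hproj (σ z)
  simp only [Function.comp_apply, tangentMap, this]
  rw [hz]

theorem IsMIntegralCurveOn.congr_eqOn {V : ∀ y : R, TangentSpace (𝓡 d) y} {γ γ' : ℝ → R}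
    {s : Set ℝ} (h : IsMIntegralCurveOn (I := 𝓡 d) γ V s) (heq : EqOn γ' γ s) :
    IsMIntegralCurveOn (I := 𝓡 d) γ' V s := by
  intro t ht
  have h1 := (h t ht).congr_mono heq (heq ht) le_rfl
  have h2 : (V (γ' t) : EuclideanSpace ℝ (Fin d)) = V (γ t) :=
    congrArg (fun y ↦ (V y : EuclideanSpace ℝ (Fin d))) (heq ht)
  refine h1.congr_mfderiv ?_
  ext1
  exact congrArg (fun w : EuclideanSpace ℝ (Fin d) ↦ (1 : ℝ) • w) h2.symm

/-- Forward uniqueness of integral curves on a half-line including its endpoint. -/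
theorem IsMIntegralCurveOn.eqOn_Ici [T2Space R] [IsManifold (𝓡 d) 1 R]
    {V : ∀ y : R, TangentSpace (𝓡 d) y}
    (hV : ContMDiff (𝓡 d) (𝓡 d).tangent 1 (fun x ↦ (⟨x, V x⟩ : TangentBundle (𝓡 d) R)))
    {γ γ' : ℝ → R} (hγ : IsMIntegralCurveOn (I := 𝓡 d) γ V (Ici 0))
    (hγ' : IsMIntegralCurveOn (I := 𝓡 d) γ' V (Ici 0)) (h0 : γ 0 = γ' 0) :
    EqOn γ γ' (Ici 0) := by
  -- Prepending the same local solution `β` for negative times extends both curves past the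
  -- endpoint, so uniqueness on open intervals applies.
  obtain ⟨β, hβ0, hβ⟩ := exists_isMIntegralCurveAt_of_contMDiffAt_boundaryless (t₀ := 0)
    (hV (γ 0))
  obtain ⟨ε, hε, hβ⟩ := isMIntegralCurveAt_iff'.1 hβ
  rw [Real.ball_eq_Ioo, zero_sub, zero_add] at hβ
  have key : ∀ {δ : ℝ → R}, IsMIntegralCurveOn (I := 𝓡 d) δ V (Ici 0) → β 0 = δ 0 → ∀ T,
      IsMIntegralCurveOn (I := 𝓡 d) (fun t ↦ if t < 0 then β t else δ t) V (Ioo (-ε) T) := by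
    intro δ hδ hβδ T
    set c : ℝ → R := fun t ↦ if t < 0 then β t else δ t with hc
    have hcβ : EqOn c β (Iic 0) := fun s hs ↦ by
      rcases (mem_Iic.1 hs).lt_or_eq with h | rfl
      · simp [hc, h]
      · simp [hc, hβδ]
    have hcδ : EqOn c δ (Ici 0) := fun s hs ↦ by simp [hc, not_lt.2 (mem_Ici.1 hs)]
    have h1 : IsMIntegralCurveOn (I := 𝓡 d) c V (Ioc (-ε) 0) :=
      (hβ.mono fun s hs ↦ ⟨hs.1, hs.2.trans_lt hε⟩).congr_eqOn (hcβ.mono fun s hs ↦ hs.2)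
    have h2 : IsMIntegralCurveOn (I := 𝓡 d) c V (Ici 0) := hδ.congr_eqOn hcδ
    intro t ht
    refine HasMFDerivAt.hasMFDerivWithinAt ?_
    rcases lt_trichotomy t 0 with h | rfl | h
    · exact (h1 t ⟨ht.1, h.le⟩).hasMFDerivAt (Ioc_mem_nhds ht.1 h)
    · refine ((h1 0 ⟨ht.1, le_rfl⟩).union (h2 0 self_mem_Ici)).hasMFDerivAt ?_
      filter_upwards [lt_mem_nhds ht.1] with s hs
      exact (le_total s 0).imp (fun h ↦ ⟨hs, h⟩) id
    · exact (h2 t h.le).hasMFDerivAt (Ici_mem_nhds h)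
  intro t ht
  have h1 := isMIntegralCurveOn_Ioo_eqOn_of_contMDiff_boundaryless (t₀ := 0)
    (a := -ε) (b := t + 1) ⟨by linarith, by linarith [mem_Ici.1 ht]⟩ hV (key hγ hβ0 (t + 1))
    (key hγ' (hβ0.trans h0) (t + 1)) (by simp [h0])
  have h2 := h1 (show t ∈ Ioo (-ε) (t + 1) from ⟨by linarith [mem_Ici.1 ht], by linarith⟩)
  simpa [not_lt.2 (mem_Ici.1 ht)] using h2

/-- A semiflow generated by a projectable vector field descends along a submersion. -/
theorem Manifold.IsSubmersion.exists_flow_of_projectable [IsManifold (𝓡 m) ∞ M] [T2Space R]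
    [IsManifold (𝓡 d) ∞ R] {π : M → R} (hπ : IsSubmersion (𝓡 m) (𝓡 d) ∞ π)
    (hsurj : Function.Surjective π) {V : ∀ x : M, TangentSpace (𝓡 m) x}
    (hV : IsVectorFieldOfClass 2 V) {VR : ∀ y : R, TangentSpace (𝓡 d) y}
    (hproj : ∀ x, mfderiv (𝓡 m) (𝓡 d) π x (V x) = VR (π x)) {φ : Flow ℝ≥0 M}
    (hφ : IsSemiflowOf φ V) :
    ∃ ψ : Flow ℝ≥0 R, (∀ t x, ψ t (π x) = π (φ t x)) ∧ IsSemiflowOf ψ VR := by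
  have hVR := (hπ.isVectorFieldOfClass_of_projectable hsurj hV hproj)
  have hVR1 : ContMDiff (𝓡 d) (𝓡 d).tangent 1
    (fun x ↦ (⟨x, VR x⟩ : TangentBundle (𝓡 d) R)) := hVR.of_le (by norm_num)
  have hcurve : ∀ x, IsMIntegralCurveOn (I := 𝓡 d) (fun t : ℝ ↦ π (φ t.toNNReal x)) VR (Ici 0) := by
    intro x t ht
    have h1 := ((hπ.contMDiff.mdifferentiableAt (by simp)
      (x := φ t.toNNReal x)).hasMFDerivAt).comp_hasMFDerivWithinAt t (hφ x t ht)
    refine h1.congr_mfderiv ?_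
    ext1
    refine (map_smul (mfderiv (𝓡 m) (𝓡 d) π (φ t.toNNReal x)) (1 : ℝ) (V _)).trans ?_
    exact congrArg _ (hproj _)
  have hwd : ∀ x x', π x = π x' → ∀ t : ℝ≥0, π (φ t x) = π (φ t x') := by
    intro x x' h t
    have := IsMIntegralCurveOn.eqOn_Ici hVR1 (hcurve x) (hcurve x') (by simpa using h)
      (show (t : ℝ) ∈ Ici 0 from t.2)
    simpa using this
  choose s hs using hsurj
  have hπs : ∀ t x, π (φ t (s (π x))) = π (φ t x) := fun t x ↦ hwd _ _ (hs _) t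
  -- The global section `s` need not be continuous. Joint continuity of the reduced semiflow comes
  -- from openness of `π`, which makes `id × π` a quotient map.
  have hq : IsOpenQuotientMap (Prod.map id π : ℝ≥0 × M → ℝ≥0 × R) :=
    IsOpenQuotientMap.id.prodMap ⟨fun y ↦ ⟨s y, hs y⟩, hπ.contMDiff.continuous, hπ.isOpenMap⟩
  refine ⟨⟨fun t y ↦ π (φ t (s y)), ?_, fun t₁ t₂ y ↦ ?_, fun y ↦ ?_⟩, hπs, fun y ↦ ?_⟩
  · rw [hq.isQuotientMap.continuous_iff]
    have : Continuous fun p : ℝ≥0 × M ↦ π (φ p.1 p.2) := hπ.contMDiff.continuous.comp φ.cont'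
    refine this.congr fun p ↦ ?_
    simp [Function.uncurry, hπs]
  · change π (φ (t₁ + t₂) (s y)) = π (φ t₁ (s (π (φ t₂ (s y)))))
    rw [hπs, φ.map_add]
  · simp [hs]
  · exact hcurve (s y)

end Submersion

/-! ### Transversal and reduced linearizations -/

section Linearization

/-- Differentiating `Df(e) v(e) = w(f(e))` yields the claim up to the term `D²f(e₀)(h, v(e₀))`. This
vanishes because `Df(e)` kills the fixed vector `v(e₀)` for all `e` near `e₀`. -/
theorem fderiv_comp_fderiv_of_related {E F : Type*} [NormedAddCommGroup E] [NormedSpace ℝ E]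
    [NormedAddCommGroup F] [NormedSpace ℝ F] {f : E → F} {v : E → E} {w : F → F} {e₀ : E}
    (hf : ContDiffAt ℝ 2 f e₀) (hv : DifferentiableAt ℝ v e₀) (hw : DifferentiableAt ℝ w (f e₀))
    (hrel : ∀ᶠ e in 𝓝 e₀, fderiv ℝ f e (v e) = w (f e))
    (hker : ∀ᶠ e in 𝓝 e₀, fderiv ℝ f e (v e₀) = 0) (h : E) :
    fderiv ℝ f e₀ (fderiv ℝ v e₀ h) = fderiv ℝ w (f e₀) (fderiv ℝ f e₀ h) := by
  have hdf : DifferentiableAt ℝ (fderiv ℝ f) e₀ :=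
    (hf.fderiv_right (m := 1) (by norm_num)).differentiableAt (by norm_num)
  have hfd : DifferentiableAt ℝ f e₀ := hf.differentiableAt (by norm_num)
  have h1 := hdf.hasFDerivAt.clm_apply hv.hasFDerivAt
  have h2 := (hw.hasFDerivAt.comp e₀ hfd.hasFDerivAt).congr_of_eventuallyEq hrel
  have h3 := hdf.hasFDerivAt.clm_apply (hasFDerivAt_const (𝕜 := ℝ) (v e₀) e₀)
  have h4 := (hasFDerivAt_const (𝕜 := ℝ) (0 : F) e₀).congr_of_eventuallyEq hker
  have h12 := DFunLike.congr_fun (h1.unique h2) h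
  have h34 := DFunLike.congr_fun (h3.unique h4) h
  simp at h12 h34
  rw [h34, add_zero] at h12
  exact h12

variable {m d : ℕ} {M : Type*} [TopologicalSpace M] [ChartedSpace (EuclideanSpace ℝ (Fin m)) M]
  {R : Type*} [TopologicalSpace R] [ChartedSpace (EuclideanSpace ℝ (Fin d)) R]

theorem mdifferentiable_of_mem_maximalAtlas [IsManifold (𝓡 m) 1 M]
    {χ : OpenPartialHomeomorph M (EuclideanSpace ℝ (Fin m))}
    (hχ : χ ∈ IsManifold.maximalAtlas (𝓡 m) 1 M) : χ.MDifferentiable (𝓡 m) (𝓡 m) :=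
  ⟨(contMDiffOn_of_mem_maximalAtlas hχ).mdifferentiableOn (by simp),
    (contMDiffOn_symm_of_mem_maximalAtlas hχ).mdifferentiableOn (by simp)⟩

theorem isInvertible_mfderiv_of_mem_maximalAtlas [IsManifold (𝓡 m) 1 M]
    {χ : OpenPartialHomeomorph M (EuclideanSpace ℝ (Fin m))}
    (hχ : χ ∈ IsManifold.maximalAtlas (𝓡 m) 1 M) {x : M} (hx : x ∈ χ.source) :
    (mfderiv (𝓡 m) (𝓡 m) χ x).IsInvertible :=
  ⟨(mdifferentiable_of_mem_maximalAtlas hχ).mfderiv hx, rfl⟩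

theorem TransversalReduction.IsVectorFieldOfClass.differentiableAt_inChart
    [IsManifold (𝓡 m) ∞ M] {W : ∀ x : M, TangentSpace (𝓡 m) x} (hW : IsVectorFieldOfClass 2 W)
    {χ : OpenPartialHomeomorph M (EuclideanSpace ℝ (Fin m))}
    (hχ : χ ∈ IsManifold.maximalAtlas (𝓡 m) ∞ M) {x : M} (hx : x ∈ χ.source) :
    DifferentiableAt ℝ (inChart χ W) (χ x) := by
  have hu : UniqueMDiffOn (𝓡 m) χ.source := χ.open_source.uniqueMDiffOn
  have h1 : ContMDiffOn (𝓡 m).tangent (𝓡 m).tangent 1 (tangentMapWithin (𝓡 m) (𝓡 m) χ χ.source)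
      (Bundle.TotalSpace.proj ⁻¹' χ.source) :=
    (contMDiffOn_of_mem_maximalAtlas hχ).contMDiffOn_tangentMapWithin (by norm_cast) hu
  have h2 : ContMDiffOn (𝓡 m) (𝓡 m).tangent 1
      (fun e ↦ (⟨χ.symm e, W (χ.symm e)⟩ : TangentBundle (𝓡 m) M)) χ.target :=
    (hW.of_le (by norm_num)).comp_contMDiffOn
      ((contMDiffOn_symm_of_mem_maximalAtlas hχ).of_le (by norm_cast))
  have h3 := h1.comp h2 fun e he ↦ χ.map_target he
  have h4 : ContMDiffOn (𝓡 m) (𝓡 m).tangent 1 (fun e ↦ (⟨e, inChart χ W e⟩ :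
      TangentBundle (𝓡 m) (EuclideanSpace ℝ (Fin m)))) χ.target := by
    refine h3.congr fun e he ↦ ?_
    simp only [Function.comp_apply, tangentMapWithin, inChart,
      mfderivWithin_of_isOpen χ.open_source (χ.map_target he)]
    rw [χ.right_inv he]
  have h5 := h4.contMDiffAt (χ.open_target.mem_nhds (χ.map_source hx))
  exact (contMDiffAt_vectorSpace_iff_contDiffAt.1 h5).differentiableAt (by norm_num)

theorem fderiv_inChart_comp_mfderiv [IsManifold (𝓡 m) ∞ M] [IsManifold (𝓡 d) ∞ R] {π : M → R}
    (hπ : ContMDiff (𝓡 m) (𝓡 d) ∞ π) {χ : OpenPartialHomeomorph M (EuclideanSpace ℝ (Fin m))}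
    (hχ : χ ∈ IsManifold.maximalAtlas (𝓡 m) ∞ M)
    {χ' : OpenPartialHomeomorph R (EuclideanSpace ℝ (Fin d))}
    (hχ' : χ' ∈ IsManifold.maximalAtlas (𝓡 d) ∞ R) {y : M} (hy : y ∈ χ.source)
    (hy' : π y ∈ χ'.source) (u : TangentSpace (𝓡 m) y) :
    fderiv ℝ (χ' ∘ π ∘ χ.symm) (χ y) (mfderiv (𝓡 m) (𝓡 m) χ y u) =
      mfderiv (𝓡 d) (𝓡 d) χ' (π y) (mfderiv (𝓡 m) (𝓡 d) π y u) := by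
  have hd1 := (contMDiffAt_of_mem_maximalAtlas hχ hy).mdifferentiableAt (by simp)
  have hd2 : ContMDiffAt (𝓡 d) (𝓡 d) ∞ χ' (π (χ.symm (χ y))) := by
    rw [χ.left_inv hy]; exact contMDiffAt_of_mem_maximalAtlas hχ' hy'
  have hF : ContMDiffAt (𝓡 m) (𝓡 d) ∞ (χ' ∘ π ∘ χ.symm) (χ y) :=
    hd2.comp (χ y) ((hπ _).comp (χ y)
      (contMDiffAt_symm_of_mem_maximalAtlas hχ (χ.map_source hy)))
  have h1 := ((hF.mdifferentiableAt (by simp)).hasMFDerivAt).comp y hd1.hasMFDerivAt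
  have h2 := (((contMDiffAt_of_mem_maximalAtlas hχ' hy').mdifferentiableAt
    (by simp)).hasMFDerivAt).comp y ((hπ y).mdifferentiableAt (by simp)).hasMFDerivAt
  have h3 : (χ' ∘ π ∘ χ.symm) ∘ χ =ᶠ[𝓝 y] χ' ∘ π := by
    filter_upwards [χ.open_source.mem_nhds hy] with z hz
    simp [χ.left_inv hz]
  have h4 := DFunLike.congr_fun (hasMFDerivAt_unique h1 (h2.congr_of_eventuallyEq h3)) u
  rw [mfderiv_eq_fderiv] at h4
  exact h4

/-- At a point where the projectable field `V` is tangent to the fibres of `π`, the differential of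
`π` intertwines the linearization of `V` in a foliated chart with the linearization of its
projection in an arbitrary chart. -/
theorem mfderiv_linearization_of_projectable [IsManifold (𝓡 m) ∞ M] [IsManifold (𝓡 d) ∞ R]
    {N : ∀ x : M, Submodule ℝ (TangentSpace (𝓡 m) x)} {π : M → R}
    (hπ : ContMDiff (𝓡 m) (𝓡 d) ∞ π)
    (hker : ∀ x, ∀ v : TangentSpace (𝓡 m) x, mfderiv (𝓡 m) (𝓡 d) π x v = 0 ↔ v ∈ N x)
    {V : ∀ x : M, TangentSpace (𝓡 m) x} (hV : IsVectorFieldOfClass 2 V)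
    {VR : ∀ y : R, TangentSpace (𝓡 d) y} (hVR : IsVectorFieldOfClass 2 VR)
    (hproj : ∀ x, mfderiv (𝓡 m) (𝓡 d) π x (V x) = VR (π x))
    {χ : OpenPartialHomeomorph M (EuclideanSpace ℝ (Fin m))} (hχ : IsFoliatedChart N χ)
    {χ' : OpenPartialHomeomorph R (EuclideanSpace ℝ (Fin d))}
    (hχ' : χ' ∈ IsManifold.maximalAtlas (𝓡 d) ∞ R) {x : M} (hx : x ∈ χ.source)
    (hx' : π x ∈ χ'.source) (hVx : V x ∈ N x) (u : TangentSpace (𝓡 m) x) :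
    mfderiv (𝓡 m) (𝓡 d) π x (linearization χ V x u) =
      linearization χ' VR (π x) (mfderiv (𝓡 m) (𝓡 d) π x u) := by
  obtain ⟨hχ, P, hP⟩ := hχ
  have hχ1 : χ ∈ IsManifold.maximalAtlas (𝓡 m) 1 M :=
    IsManifold.maximalAtlas_subset_of_le (by norm_cast) hχ
  have hχ1' : χ' ∈ IsManifold.maximalAtlas (𝓡 d) 1 R :=
    IsManifold.maximalAtlas_subset_of_le (by norm_cast) hχ'
  have hinv := isInvertible_mfderiv_of_mem_maximalAtlas hχ1 hx
  have hinv' := isInvertible_mfderiv_of_mem_maximalAtlas hχ1' hx'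
  let f := χ' ∘ π ∘ χ.symm
  have hfx : f (χ x) = χ' (π x) := by simp [f, χ.left_inv hx]
  have hf : ContDiffAt ℝ 2 f (χ x) := by
    have h1 : ContMDiffAt (𝓡 d) (𝓡 d) ∞ χ' (π (χ.symm (χ x))) := by
      rw [χ.left_inv hx]; exact contMDiffAt_of_mem_maximalAtlas hχ' hx'
    have h2 : ContMDiffAt (𝓡 m) (𝓡 d) ∞ (χ' ∘ π ∘ χ.symm) (χ x) :=
      h1.comp (χ x) ((hπ _).comp (χ x) (contMDiffAt_symm_of_mem_maximalAtlas hχ (χ.map_source hx)))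
    exact (contMDiffAt_iff_contDiffAt.1 h2).of_le (by norm_cast)
  have hnear : ∀ᶠ e in 𝓝 (χ x), e ∈ χ.target ∧ π (χ.symm e) ∈ χ'.source := by
    refine (χ.open_target.eventually_mem (χ.map_source hx)).and ?_
    have hc : ContinuousAt (π ∘ χ.symm) (χ x) :=
      hπ.continuous.continuousAt.comp (χ.continuousAt_symm (χ.map_source hx))
    refine hc.eventually_mem (χ'.open_source.mem_nhds ?_)
    simpa [χ.left_inv hx] using hx'
  have hG : ∀ e ∈ χ.target, π (χ.symm e) ∈ χ'.source → ∀ w : TangentSpace (𝓡 m) (χ.symm e),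
      fderiv ℝ f e (mfderiv (𝓡 m) (𝓡 m) χ (χ.symm e) w) =
        mfderiv (𝓡 d) (𝓡 d) χ' (π (χ.symm e)) (mfderiv (𝓡 m) (𝓡 d) π (χ.symm e) w) := by
    intro e he he' w
    have := fderiv_inChart_comp_mfderiv hπ hχ hχ' (χ.map_target he) he' w
    rwa [χ.right_inv he] at this
  have key := fderiv_comp_fderiv_of_related (v := inChart χ V) (w := inChart χ' VR) hf
    (hV.differentiableAt_inChart hχ hx) (by rw [hfx]; exact hVR.differentiableAt_inChart hχ' hx')
    (by
      filter_upwards [hnear] with e he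
      have h1 := hG e he.1 he.2 (V (χ.symm e))
      have h2 := inChart_apply (χ := χ') VR he.2
      rw [hproj] at h1
      exact h1.trans h2.symm)
    (by
      filter_upwards [hnear] with e he
      -- Here the chart must be foliated: since the distribution is the constant subspace `P`, the
      -- vector representing `V x` lies in the kernel of `Df(e)` at every nearby `e`.
      have h1 : inChart χ V (χ x) ∈ P := by
        rw [inChart_apply V hx]; exact (hP x hx _).1 hVx
      obtain ⟨w, hw⟩ := (isInvertible_mfderiv_of_mem_maximalAtlas hχ1
        (χ.map_target he.1)).bijective.surjective (inChart χ V (χ x))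
      have h2 : w ∈ N (χ.symm e) := (hP _ (χ.map_target he.1) w).2 (by rw [hw]; exact h1)
      have h3 := hG e he.1 he.2 w
      rw [(hker _ w).2 h2, map_zero, hw] at h3
      exact h3)
    (mfderiv (𝓡 m) (𝓡 m) χ x u)
  have hGx := fun w ↦ fderiv_inChart_comp_mfderiv hπ hχ hχ' hx hx' w
  have e1 := hGx (linearization χ V x u)
  have e2 : mfderiv (𝓡 m) (𝓡 m) χ x (linearization χ V x u) =
      fderiv ℝ (inChart χ V) (χ x) (mfderiv (𝓡 m) (𝓡 m) χ x u) :=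
    hinv.self_apply_inverse _
  have e3 : mfderiv (𝓡 d) (𝓡 d) χ' (π x) (linearization χ' VR (π x)
      (mfderiv (𝓡 m) (𝓡 d) π x u)) = fderiv ℝ (inChart χ' VR) (χ' (π x))
      (mfderiv (𝓡 d) (𝓡 d) χ' (π x) (mfderiv (𝓡 m) (𝓡 d) π x u)) :=
    hinv'.self_apply_inverse _
  refine hinv'.bijective.injective ?_
  rw [e3, ← hGx u, ← e1, e2, ← hfx]
  exact key

/-- Since `S x` is a complement of `ker dπ`, `dπ` maps it isomorphically onto the tangent space at
`π x`. Projecting to `S x` changes a vector only by an element of that kernel, so this isomorphism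
conjugates the two operators. -/
theorem complexSpectrum_transversalLinearization [IsManifold (𝓡 m) ∞ M] [IsManifold (𝓡 d) ∞ R]
    {N S : ∀ x : M, Submodule ℝ (TangentSpace (𝓡 m) x)} (hSN : ∀ x, IsCompl (S x) (N x))
    {π : M → R} (hπ : IsSubmersion (𝓡 m) (𝓡 d) ∞ π)
    (hker : ∀ x, ∀ v : TangentSpace (𝓡 m) x, mfderiv (𝓡 m) (𝓡 d) π x v = 0 ↔ v ∈ N x)
    {V : ∀ x : M, TangentSpace (𝓡 m) x} (hV : IsVectorFieldOfClass 2 V)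
    {VR : ∀ y : R, TangentSpace (𝓡 d) y} (hVR : IsVectorFieldOfClass 2 VR)
    (hproj : ∀ x, mfderiv (𝓡 m) (𝓡 d) π x (V x) = VR (π x))
    {χ : OpenPartialHomeomorph M (EuclideanSpace ℝ (Fin m))} (hχ : IsFoliatedChart N χ)
    {χ' : OpenPartialHomeomorph R (EuclideanSpace ℝ (Fin d))}
    (hχ' : χ' ∈ IsManifold.maximalAtlas (𝓡 d) ∞ R) {x : M} (hx : x ∈ χ.source)
    (hx' : π x ∈ χ'.source) (hVx : V x ∈ N x) :
    complexSpectrum (transversalLinearization hSN χ V x) =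
      complexSpectrum (linearization χ' VR (π x) :
        TangentSpace (𝓡 d) (π x) →ₗ[ℝ] TangentSpace (𝓡 d) (π x)) := by
  let T : TangentSpace (𝓡 m) x →ₗ[ℝ] TangentSpace (𝓡 d) (π x) := mfderiv (𝓡 m) (𝓡 d) π x
  have hTker : ∀ v, T v = 0 ↔ v ∈ N x := hker x
  have hTproj : ∀ v, T ((S x).projection (N x) (hSN x) v) = T v := by
    intro v
    rw [← sub_eq_zero, ← map_sub, hTker, ← neg_mem_iff, neg_sub]
    exact Submodule.sub_projection_mem (hSN x) v
  have hinj : Function.Injective (T ∘ₗ (S x).subtype) := by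
    rw [← LinearMap.ker_eq_bot, LinearMap.ker_eq_bot']
    intro v hv
    have h1 : (v : TangentSpace (𝓡 m) x) ∈ S x ⊓ N x := ⟨v.2, (hTker _).1 hv⟩
    rw [(hSN x).inf_eq_bot, Submodule.mem_bot] at h1
    exact Subtype.ext h1
  have hsurj : Function.Surjective (T ∘ₗ (S x).subtype) := by
    intro w
    obtain ⟨v, rfl⟩ := (hπ.isSubmersionAt x).mfderiv_surjective w
    exact ⟨(S x).projectionOnto (N x) (hSN x) v, hTproj v⟩
  have : FiniteDimensional ℝ (TangentSpace (𝓡 m) x) :=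
    inferInstanceAs (FiniteDimensional ℝ (EuclideanSpace ℝ (Fin m)))
  refine complexSpectrum_conj (LinearEquiv.ofBijective _ ⟨hinj, hsurj⟩) fun v ↦ ?_
  have h1 := mfderiv_linearization_of_projectable hπ.contMDiff hker hV hVR hproj hχ hχ' hx hx' hVx v
  exact (hTproj _).trans h1

theorem complexSpectrum_linearization [IsManifold (𝓡 d) 1 R]
    {χ : OpenPartialHomeomorph R (EuclideanSpace ℝ (Fin d))}
    (hχ : χ ∈ IsManifold.maximalAtlas (𝓡 d) 1 R) {y : R} (hy : y ∈ χ.source)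
    (W : ∀ y : R, TangentSpace (𝓡 d) y) :
    complexSpectrum (linearization χ W y : TangentSpace (𝓡 d) y →ₗ[ℝ] TangentSpace (𝓡 d) y) =
      complexSpectrum (fderiv ℝ (inChart χ W) (χ y) :
        EuclideanSpace ℝ (Fin d) →ₗ[ℝ] EuclideanSpace ℝ (Fin d)) := by
  have : FiniteDimensional ℝ (TangentSpace (𝓡 d) y) :=
    inferInstanceAs (FiniteDimensional ℝ (EuclideanSpace ℝ (Fin d)))
  have hinv := isInvertible_mfderiv_of_mem_maximalAtlas hχ hy
  exact complexSpectrum_conj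
    ((mdifferentiable_of_mem_maximalAtlas hχ).mfderiv hy).toLinearEquiv
    fun v ↦ hinv.self_apply_inverse _

end Linearization

/-! ### Lorentzian algebra at zeros of the dissipation -/

section Lorentz

/-- In a Lorentzian vector space, a vector orthogonal to a nonzero null vector and not spacelike is
a multiple of it. -/
theorem TransversalReduction.LorentzianMetric.exists_eq_smul_of_orthogonal_null {n : ℕ} {U : Type*}
    [TopologicalSpace U] [ChartedSpace (EuclideanSpace ℝ (Fin (n + 1))) U]
    [IsManifold (𝓡 (n + 1)) ∞ U] (g : LorentzianMetric n U) {x : U}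
    {ν v : TangentSpace (𝓡 (n + 1)) x} (hν0 : ν ≠ 0) (hν : g.val x ν ν = 0)
    (hνv : g.val x ν v = 0) (hv : g.val x v v ≤ 0) : ∃ c : ℝ, v = c • ν := by
  obtain ⟨b, hb⟩ := g.signature x
  have hexp : ∀ v w : TangentSpace (𝓡 (n + 1)) x, g.val x v w =
      -(b.repr v 0 * b.repr w 0) + ∑ i : Fin n, b.repr v i.succ * b.repr w i.succ := by
    intro v w
    conv_lhs => rw [← b.sum_repr v, ← b.sum_repr w]
    simp only [map_sum, map_smul, sum_apply, smul_apply, hb, smul_eq_mul]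
    simp [Fin.sum_univ_succ, Fin.succ_ne_zero]
    simp only [mul_comm]
  have hzero : ∀ w : TangentSpace (𝓡 (n + 1)) x, b.repr w 0 = 0 → g.val x w w ≤ 0 → w = 0 := by
    intro w h0 hw
    rw [hexp, h0, mul_zero, neg_zero, zero_add] at hw
    have h1 : ∑ i : Fin n, b.repr w i.succ * b.repr w i.succ = 0 :=
      le_antisymm hw (Finset.sum_nonneg fun i _ ↦ mul_self_nonneg _)
    rw [Finset.sum_eq_zero_iff_of_nonneg fun i _ ↦ mul_self_nonneg _] at h1
    refine b.repr.map_eq_zero_iff.1 (Finsupp.ext fun i ↦ ?_)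
    refine Fin.cases h0 (fun i ↦ ?_) i
    exact mul_self_eq_zero.1 (h1 i (Finset.mem_univ i))
  -- A nonzero null vector has a time component, so subtracting a multiple of `ν` removes that of
  -- `v`. Orthogonality keeps the difference non-spacelike, hence it is zero.
  have hn0 : b.repr ν 0 ≠ 0 := fun h ↦ hν0 (hzero ν h hν.le)
  refine ⟨b.repr v 0 / b.repr ν 0, ?_⟩
  rw [← sub_eq_zero]
  refine hzero _ ?_ ?_
  · simp [hn0]
  · have hvν : g.val x v ν = 0 := by rw [g.symm, hνv]
    simpa [hν, hνv, hvν] using hv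

/-- Compatibility turns `dΨ(V) = 0` into `dΨ(V_S) = 0`, so the estimate gives `g(V_S, V_S) ≤ 0`. A
nonzero null direction is orthogonal to `V_S`, which is therefore a multiple of it. -/
theorem TransversalReduction.TransversalDissipation.mem_nullDistribution {m n : ℕ} {U M : Type*}
    [TopologicalSpace U] [ChartedSpace (EuclideanSpace ℝ (Fin (n + 1))) U]
    [IsManifold (𝓡 (n + 1)) ∞ U]
    [TopologicalSpace M] [ChartedSpace (EuclideanSpace ℝ (Fin m)) M]
    {g : LorentzianMetric n U} {ι : M → U}
    (hι : ∀ x, Function.Injective (mfderiv (𝓡 m) (𝓡 (n + 1)) ι x))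
    {S : ∀ x : M, Submodule ℝ (TangentSpace (𝓡 m) x)}
    {hSN : ∀ x, IsCompl (S x) (nullDistribution g ι x)}
    {V : ∀ x : M, TangentSpace (𝓡 m) x} {Ψ : M → ℝ} (hdiss : TransversalDissipation g ι hSN V Ψ)
    (hcomp : IsCompatible (nullDistribution (m := m) g ι) Ψ) {x : M}
    (hN : nullDistribution (m := m) g ι x ≠ ⊥) (hx : mvfderiv (𝓡 m) Ψ x (V x) = 0) :
    V x ∈ nullDistribution g ι x := by
  obtain ⟨c, hc, hdiss⟩ := hdiss
  set W := (S x).projection (nullDistribution g ι x) (hSN x) (V x) with hW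
  have hsub : V x - W ∈ nullDistribution g ι x := Submodule.sub_projection_mem (hSN x) (V x)
  have h1 : mvfderiv (𝓡 m) Ψ x W = 0 := by
    have := hcomp x _ hsub
    rw [map_sub, hx, zero_sub, neg_eq_zero] at this
    exact this
  have h2 : inducedForm g ι x W W ≤ 0 := by
    have := hdiss x
    rw [← hW, h1] at this
    nlinarith
  obtain ⟨ν, hν, hν0⟩ := Submodule.exists_mem_ne_zero_of_ne_bot hN
  have hν' : ∀ w, inducedForm g ι x ν w = 0 := hν
  obtain ⟨a, ha⟩ := g.exists_eq_smul_of_orthogonal_null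
    (fun h ↦ hν0 (hι x (h.trans (map_zero _).symm))) (hν' ν) (hν' W) h2
  have h3 : W = a • ν := hι x (by rw [ha, map_smul])
  have h4 : W ∈ nullDistribution g ι x := h3 ▸ Submodule.smul_mem _ a hν
  simpa using add_mem hsub h4

end Lorentz

/-! ### Local finiteness of the covering dimension -/

section CoveringDimension

/-- Sup-norm balls of radius `h` centred on the lattice `h ℤ^d` refine the cover once `2h` is a
Lebesgue number. A point lies in at most `2 ^ d` of them, a crude bound that suffices for
finiteness. -/
theorem coveringDimLE_of_isEmbedding {X : Type*} [TopologicalSpace X] [CompactSpace X] {d : ℕ}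
    {f : X → Fin d → ℝ} (hf : IsEmbedding f) : CoveringDimLE X (2 ^ d) := by
  intro c _ hopen hcov
  let _ : MetricSpace X := hf.comapMetricSpace f
  have hdist : ∀ x y : X, dist x y = dist (f x) (f y) := fun _ _ ↦ rfl
  obtain ⟨δ, hδ, hball⟩ := lebesgue_number_lemma_of_metric_sUnion isCompact_univ hopen hcov.ge
  let h := δ / 2
  have hh : 0 < h := by positivity
  let B : (Fin d → ℤ) → Set X := fun z ↦ f ⁻¹' Metric.ball (fun i ↦ h * z i) h
  refine ⟨{u | u.Nonempty ∧ ∃ z, B z = u}, ?_, ?_, ?_, fun x ↦ ?_⟩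
  · rintro _ ⟨-, z, rfl⟩
    exact Metric.isOpen_ball.preimage hf.continuous
  · refine eq_univ_of_forall fun x ↦ ?_
    have hx : x ∈ B fun i ↦ round (f x i / h) := by
      rw [mem_preimage, Metric.mem_ball, dist_pi_lt_iff hh]
      intro i
      have h1 := abs_sub_round (f x i / h)
      rw [Real.dist_eq]
      have h2 : f x i - h * round (f x i / h) = h * (f x i / h - round (f x i / h)) := by
        field_simp
      rw [h2, abs_mul, abs_of_pos hh]
      nlinarith
    exact ⟨_, ⟨⟨x, hx⟩, _, rfl⟩, hx⟩
  · rintro _ ⟨⟨x, hx⟩, z, rfl⟩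
    obtain ⟨t, ht, hsub⟩ := hball x (mem_univ x)
    refine ⟨t, ht, fun y hy ↦ hsub ?_⟩
    rw [Metric.mem_ball, hdist]
    have h1 : dist (f y) _ < h := hy
    have h2 : dist (f x) _ < h := hx
    calc dist (f y) (f x) ≤ _ := dist_triangle_right _ _ (fun i ↦ h * (z i : ℝ))
      _ < h + h := add_lt_add h1 h2
      _ = δ := add_halves δ
  -- `|f x i / h - z i| < 1` leaves at most two integers for each coordinate.
  · let Z : Finset (Fin d → ℤ) := Fintype.piFinset fun i ↦ {⌊f x i / h⌋, ⌊f x i / h⌋ + 1}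
    have hsub : {u ∈ {u | u.Nonempty ∧ ∃ z, B z = u} | x ∈ u} ⊆ B '' (Z : Set (Fin d → ℤ)) := by
      rintro _ ⟨⟨-, z, rfl⟩, hx⟩
      refine ⟨z, ?_, rfl⟩
      rw [Finset.mem_coe, Fintype.mem_piFinset]
      intro i
      have h1 := (dist_pi_lt_iff hh).1 (Metric.mem_ball.1 hx) i
      rw [Real.dist_eq, abs_lt] at h1
      have h2 : f x i / h < (z i : ℝ) + 1 := by rw [div_lt_iff₀ hh]; nlinarith
      have h3 : (z i : ℝ) - 1 < f x i / h := by rw [lt_div_iff₀ hh]; nlinarith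
      have h4 : ⌊f x i / h⌋ < z i + 1 := Int.floor_lt.2 (by exact_mod_cast h2)
      have h5 : z i - 1 ≤ ⌊f x i / h⌋ := Int.le_floor.2 (by exact_mod_cast h3.le)
      rw [Finset.mem_insert, Finset.mem_singleton]
      omega
    have hcard : Z.card ≤ 2 ^ d := by
      rw [Fintype.card_piFinset]
      exact (Finset.prod_le_prod' fun i _ ↦ Finset.card_le_two).trans (by simp)
    calc _ ≤ (B '' (Z : Set (Fin d → ℤ))).encard := encard_le_encard hsub
      _ ≤ (Z : Set (Fin d → ℤ)).encard := encard_image_le _ _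
      _ = Z.card := encard_coe_eq_coe_finsetCard Z
      _ ≤ ((2 ^ d : ℕ) : ℕ∞) := by exact_mod_cast hcard
      _ ≤ _ := le_self_add

theorem IsCompact.locallyFiniteDimensional {d : ℕ} {R : Type*} [TopologicalSpace R] [T2Space R]
    [ChartedSpace (EuclideanSpace ℝ (Fin d)) R] {s : Set R} (hs : IsCompact s) :
    LocallyFiniteDimensional s := by
  intro y hy
  have : LocallyCompactSpace R := ChartedSpace.locallyCompactSpace (EuclideanSpace ℝ (Fin d)) R
  let χ := chartAt (EuclideanSpace ℝ (Fin d)) y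
  obtain ⟨K, hK, hKs, hKc⟩ := local_compact_nhds
    (χ.open_source.mem_nhds (mem_chart_source (EuclideanSpace ℝ (Fin d)) y))
  refine ⟨s ∩ K, inter_mem self_mem_nhdsWithin (mem_nhdsWithin_of_mem_nhds hK),
    inter_subset_left, 2 ^ d, ?_⟩
  have : CompactSpace ↥(s ∩ K) := isCompact_iff_compactSpace.1 (hs.inter hKc)
  let f : ↥(s ∩ K) → Fin d → ℝ := fun z ↦ (χ z).ofLp
  have hχK : ContinuousOn χ (s ∩ K) := χ.continuousOn.mono fun z hz ↦ hKs hz.2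
  have hfc : Continuous f :=
    (PiLp.continuous_ofLp 2 _).comp (continuousOn_iff_continuous_domRestrict.1 hχK)
  have hfi : Function.Injective f := fun z w hzw ↦
    Subtype.ext (χ.injOn (hKs z.2.2) (hKs w.2.2) (WithLp.ofLp_injective 2 hzw))
  exact coveringDimLE_of_isEmbedding (hfc.isClosedEmbedding hfi).isEmbedding

end CoveringDimension

/-! ### Zeros of the dissipation along backward orbits -/

section Dissipation

/-- Through the backward orbits of a point `x` of a compact invariant set one reaches points
arbitrarily close to some zero `p` of the derivative of `Ψ` along the semiflow. -/
theorem exists_zero_of_hasDerivAt_along_flow {M : Type*} [MetricSpace M] {φ : Flow ℝ≥0 M}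
    {A : Set M} (hA : IsCompact A) (hinv : ∀ t, φ t '' A = A) {Ψ D : M → ℝ} (hΨ : Continuous Ψ)
    (hD : Continuous D)
    (hder : ∀ y, ∀ t : ℝ, 0 < t →
      HasDerivAt (fun s : ℝ ↦ Ψ (φ s.toNNReal y)) (D (φ t.toNNReal y)) t) {x : M} (hx : x ∈ A) :
    ∃ p ∈ A, D p = 0 ∧ ∃ z : ℕ → M, ∃ τ : ℕ → ℝ≥0, Tendsto z atTop (𝓝 p) ∧
      ∀ n, φ (τ n) (z n) = x := by
  obtain ⟨C, hC⟩ := hA.exists_bound_of_continuousOn hΨ.continuousOn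
  have h1 : ∀ n : ℕ, ∃ z ∈ A, ∃ τ : ℝ≥0, φ τ z = x ∧ ‖D z‖ ≤ (2 * C) * (1 / ((n : ℝ) + 1)) := by
    intro n
    obtain ⟨y, hy, hyx⟩ : x ∈ φ (n + 1 : ℝ≥0) '' A := by rw [hinv]; exact hx
    have hn : (0 : ℝ) < n + 1 := by positivity
    have hn' : ((n : ℝ) + 1).toNNReal = n + 1 := by
      rw [Real.toNNReal_add (by positivity) (by positivity)]
      simp
    -- On an orbit segment of length `n + 1` ending at `x`, the mean slope of `Ψ` is at most `2C /
    -- (n + 1)` in absolute value. The point realizing it still reaches `x`, after the remaining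
    -- time `n + 1 - s`.
    obtain ⟨s, hs, hsl⟩ := exists_hasDerivAt_eq_slope (fun s : ℝ ↦ Ψ (φ s.toNNReal y))
      (fun s ↦ D (φ s.toNNReal y)) hn (by fun_prop) fun s hs ↦ hder y s hs.1
    refine ⟨φ s.toNNReal y, ?_, (n + 1 : ℝ≥0) - s.toNNReal, ?_, ?_⟩
    · rw [← hinv s.toNNReal]; exact ⟨y, hy, rfl⟩
    · rw [← φ.map_add, tsub_add_cancel_of_le, hyx]
      rw [← hn']
      exact Real.toNNReal_le_toNNReal hs.2.le
    · have h2 := hC y hy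
      have h3 := hC x hx
      rw [hsl, hn', hyx, sub_zero, Real.toNNReal_zero, φ.map_zero_apply, norm_div,
        Real.norm_of_nonneg hn.le, div_eq_mul_one_div]
      gcongr
      exact (norm_sub_le _ _).trans (by linarith)
  choose z hz τ hτ hDz using h1
  obtain ⟨p, hp, s, hs, hlim⟩ := hA.tendsto_subseq hz
  refine ⟨p, hp, ?_, z ∘ s, τ ∘ s, hlim, fun n ↦ hτ _⟩
  refine tendsto_nhds_unique ((hD.tendsto p).comp hlim) ?_
  have h4 : Tendsto (fun n ↦ D (z n)) atTop (𝓝 0) := by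
    refine squeeze_zero_norm hDz ?_
    simpa using (tendsto_one_div_add_atTop_nhds_zero_nat (𝕜 := ℝ)).const_mul (2 * C)
  exact h4.comp hs.tendsto_atTop

variable {m : ℕ} {M : Type*} [TopologicalSpace M] [ChartedSpace (EuclideanSpace ℝ (Fin m)) M]

theorem continuous_mvfderiv_apply [IsManifold (𝓡 m) 1 M] {Ψ : M → ℝ}
    (hΨ : ContMDiff (𝓡 m) 𝓘(ℝ, ℝ) 1 Ψ) {V : ∀ x : M, TangentSpace (𝓡 m) x}
    (hV : IsVectorFieldOfClass 0 V) : Continuous fun x ↦ mvfderiv (𝓡 m) Ψ x (V x) := by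
  have h1 := (hΨ.continuous_tangentMap le_rfl).comp hV.continuous
  exact (contMDiff_snd_tangentBundle_modelSpace (n := 0) ℝ 𝓘(ℝ, ℝ)).continuous.comp h1

theorem TransversalReduction.IsSemiflowOf.hasDerivAt_comp {φ : Flow ℝ≥0 M}
    {V : ∀ x : M, TangentSpace (𝓡 m) x} (hφ : IsSemiflowOf φ V) {Ψ : M → ℝ}
    (hΨ : ContMDiff (𝓡 m) 𝓘(ℝ, ℝ) 1 Ψ) (y : M) {t : ℝ} (ht : 0 < t) :
    HasDerivAt (fun s : ℝ ↦ Ψ (φ s.toNNReal y))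
      (mvfderiv (𝓡 m) Ψ (φ t.toNNReal y) (V (φ t.toNNReal y))) t := by
  have h1 := ((hΨ.mdifferentiableAt (by simp) (x := φ t.toNNReal y)).hasMFDerivAt).comp t
    (hφ.hasMFDerivAt y ht)
  let L : ℝ →L[ℝ] ℝ := (mfderiv (𝓡 m) 𝓘(ℝ, ℝ) Ψ (φ t.toNNReal y)).comp
    ((1 : ℝ →L[ℝ] ℝ).smulRight (V (φ t.toNNReal y)))
  have h2 : HasFDerivAt (fun s : ℝ ↦ Ψ (φ s.toNNReal y)) L t := hasMFDerivAt_iff_hasFDerivAt.1 h1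
  have h3 : mvfderiv (𝓡 m) Ψ (φ t.toNNReal y) (V (φ t.toNNReal y)) = L 1 := by
    change _ = mvfderiv (𝓡 m) Ψ (φ t.toNNReal y) ((1 : ℝ) • V (φ t.toNNReal y))
    rw [one_smul]
  rw [h3]
  exact h2.hasDerivAt

end Dissipation

/-! ### The reduced attractor consists of stable equilibria -/

theorem theorem3 {d k : ℕ} (hk : 1 ≤ k)
    -- the ambient Lorentzian phase space
    {U : Type*} [TopologicalSpace U] [T2Space U] [SecondCountableTopology U]
    [ChartedSpace (EuclideanSpace ℝ (Fin (d + k + 1))) U] [IsManifold (𝓡 (d + k + 1)) ∞ U]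
    (g : LorentzianMetric (d + k) U)
    -- the constraint hypersurface
    {M : Type*} [MetricSpace M] [ChartedSpace (EuclideanSpace ℝ (Fin (d + k))) M]
    [IsManifold (𝓡 (d + k)) ∞ M]
    (Φ : U → ℝ) (ι : M → U) (hι : IsRegularZeroSet (m := d + k) (n := d + k + 1) Φ ι)
    -- constant corank of the induced form, and a transversal complement of the null distribution
    (hcorank : ∀ x : M, Module.finrank ℝ (nullDistribution (m := d + k) g ι x) = k)
    (S : ∀ x : M, Submodule ℝ (TangentSpace (𝓡 (d + k)) x))
    (hS : IsSmoothDistribution S d)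
    (hSN : ∀ x, IsCompl (S x) (nullDistribution g ι x))
    -- the intrinsic vector field and its semiflow
    (V : ∀ x : M, TangentSpace (𝓡 (d + k)) x) (hV : IsVectorFieldOfClass 2 V)
    (φ : Flow ℝ≥0 M) (hφ : IsSemiflowOf φ V)
    (hcompact : AsymptoticallyCompact φ) (habs : HasBoundedAbsorbingSet φ)
    -- the null distribution is involutive with compact embedded leaves; the leaf space
    (hinv : IsInvolutive (nullDistribution (m := d + k) g ι))
    (hleaf : ∀ x, IsCompact (leaf (nullDistribution (m := d + k) g ι) x))
    {R : Type*} [TopologicalSpace R] [T2Space R] [SecondCountableTopology R]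
    [ChartedSpace (EuclideanSpace ℝ (Fin d)) R] [IsManifold (𝓡 d) ∞ R]
    (π : M → R) (hπ : IsLeafSpace (d := d) (nullDistribution (m := d + k) g ι) π)
    -- projectability of the vector field
    (VR : ∀ y : R, TangentSpace (𝓡 d) y)
    (hproj : ∀ x, mfderiv (𝓡 (d + k)) (𝓡 d) π x (V x) = VR (π x))
    -- the functional
    (Ψ : M → ℝ) (hΨ : ContMDiff (𝓡 (d + k)) 𝓘(ℝ, ℝ) 2 Ψ)
    (hcomp : IsCompatible (nullDistribution (m := d + k) g ι) Ψ)
    (hdiss : TransversalDissipation g ι hSN V Ψ)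
    (hmorse : TransversallyMorse S V Ψ)
    -- uniform transversal spectral gap on the global attractor
    (hgap : ∃ η : ℝ, 0 < η ∧ ∀ A : Set M, IsGlobalAttractor φ A → ∀ x ∈ A,
      ∃ χ : OpenPartialHomeomorph M (EuclideanSpace ℝ (Fin (d + k))),
        IsFoliatedChart (nullDistribution g ι) χ ∧ x ∈ χ.source ∧
        complexSpectrum (transversalLinearization hSN χ V x) ∩ {z : ℂ | -η ≤ z.re} = ∅) :
    ∃ A : Set M, IsGlobalAttractor φ A ∧
      ∃ ψ : Flow ℝ≥0 R, (∀ t x, ψ t (π x) = π (φ t x)) ∧ IsSemiflowOf ψ VR ∧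
        IsCompact (π '' A) ∧ (∀ t, ψ t '' (π '' A) = π '' A) ∧
        LocallyFiniteDimensional (π '' A) ∧
        ∀ y ∈ π '' A, ∀ χ ∈ IsManifold.maximalAtlas (𝓡 d) ∞ R, y ∈ χ.source →
          complexSpectrum (linearization χ VR y : TangentSpace (𝓡 d) y →ₗ[ℝ] TangentSpace (𝓡 d) y)
            ∩ {z : ℂ | z.re = 0} = ∅ := by
  obtain ⟨B, hB, hBabs⟩ := habs
  have hA := hcompact.isGlobalAttractor_seqOmegaLimit hB hBabs
  set A := seqOmegaLimit φ B
  obtain ⟨ψ, hψπ, hψ⟩ := hπ.submersion.exists_flow_of_projectable hπ.surjective hV hproj hφ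
  have hVR := hπ.submersion.isVectorFieldOfClass_of_projectable hπ.surjective hV hproj
  have hπc : Continuous π := hπ.submersion.contMDiff.continuous
  have hAc : IsCompact (π '' A) := hA.isCompact.image hπc
  refine ⟨A, hA, ψ, hψπ, hψ, hAc, fun t ↦ ?_, hAc.locallyFiniteDimensional (d := d), ?_⟩
  · rw [image_image]
    simp only [hψπ]
    rw [← image_image (g := π) (f := φ t), hA.invariant]
  obtain ⟨η, hη, hgap⟩ := hgap
  have hN : ∀ x, nullDistribution (m := d + k) g ι x ≠ ⊥ := by
    intro x h
    have := hcorank x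
    rw [h, finrank_bot] at this
    omega
  have hιinj : ∀ x, Function.Injective (mfderiv (𝓡 (d + k)) (𝓡 (d + k + 1)) ι x) := fun x ↦
    (hι.embedding.isImmersion.isImmersionAt x).mfderiv_injective
  have hspec : ∀ p ∈ A, V p ∈ nullDistribution (m := d + k) g ι p →
      ∀ χ ∈ IsManifold.maximalAtlas (𝓡 d) ∞ R, π p ∈ χ.source →
        ∀ z ∈ complexSpectrum (linearization χ VR (π p) :
          TangentSpace (𝓡 d) (π p) →ₗ[ℝ] TangentSpace (𝓡 d) (π p)), z.re < 0 := by
    intro p hp hVp χ' hχ' hpχ' z hz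
    obtain ⟨χ, hχ, hpχ, hempty⟩ := hgap A hA p hp
    rw [← complexSpectrum_transversalLinearization hSN hπ.submersion hπ.ker_eq hV hVR hproj hχ hχ'
      hpχ hpχ' hVp] at hz
    by_contra! hre
    exact (hempty.subset ⟨hz, show -η ≤ z.re by linarith⟩ : z ∈ (∅ : Set ℂ))
  -- The spectrum is controlled only where `V` is tangent to the leaves; this carries the control to
  -- all of `π '' A`.
  have hequil : ∀ x ∈ A, ∃ p ∈ A, V p ∈ nullDistribution (m := d + k) g ι p ∧ π x = π p := by
    intro x hx
    obtain ⟨p, hp, hDp, z, τ, hz, hτ⟩ := exists_zero_of_hasDerivAt_along_flow hA.isCompact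
      hA.invariant hΨ.continuous (continuous_mvfderiv_apply (hΨ.of_le (by norm_num))
        (hV.of_le (by norm_num))) (fun y t ht ↦ hφ.hasDerivAt_comp (hΨ.of_le (by norm_num)) y ht) hx
    have hVp := hdiss.mem_nullDistribution hιinj hcomp (hN p) hDp
    refine ⟨p, hp, hVp, ?_⟩
    have hVRp : VR (π p) = 0 := by
      rw [← hproj, hπ.ker_eq]
      exact hVp
    let χ := chartAt (EuclideanSpace ℝ (Fin d)) (π p)
    have hχ : χ ∈ IsManifold.maximalAtlas (𝓡 d) ∞ R := IsManifold.chart_mem_maximalAtlas _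
    have hχ1 : χ ∈ IsManifold.maximalAtlas (𝓡 d) 1 R := IsManifold.chart_mem_maximalAtlas _
    have hpχ : π p ∈ χ.source := mem_chart_source _ _
    have hneg := hspec p hp hVp χ hχ hpχ
    rw [complexSpectrum_linearization hχ1 hpχ] at hneg
    by_contra hne
    -- Stability is tested on the complement of `π x`: orbits starting close enough to `π p` would
    -- never meet `π x`, yet the projected `z n` reach it at time `τ n`.
    have hU : {π x}ᶜ ∈ 𝓝 (π p) := isOpen_compl_singleton.mem_nhds fun h ↦ hne h.symm
    obtain ⟨W, hW, hWU⟩ := hψ.stable_of_complexSpectrum hVRp hχ1 hpχ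
      (hVR.differentiableAt_inChart hχ hpχ) hneg hU
    obtain ⟨n, hn⟩ := (((hπc.tendsto p).comp hz).eventually_mem hW).exists
    refine hWU _ hn (τ n) ?_
    rw [mem_singleton_iff, Function.comp_apply, hψπ, hτ]
  rintro _ ⟨x, hx, rfl⟩ χ hχ hxχ
  obtain ⟨p, hp, hVp, hxp⟩ := hequil x hx
  rw [hxp] at hxχ ⊢
  rw [eq_empty_iff_forall_notMem]
  rintro z ⟨hz, hz0⟩
  exact (hspec p hp hVp χ hχ hxχ z hz).ne hz0
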